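/- **Permutations.** Write a permutation $w\in\mathfrak S_n$ in one-line notation $w(1)\cdots w(n)$, multiply permutations as maps, and let $\ell(w)$ be the least number of adjacent transpositions with product $w$. For $p\in\mathfrak S_k$, an occurrence of $p$ in $w$ is a subsequence $w(j_1)\cdots w(j_k)$, $j_1<\dots<j_k$, in the same relative order as $p(1)\cdots p(k)$. The pair $(p,w)$ is *value-stable* if $w=w'v$ with $w',v\in\mathfrak S_n$, $\ell(w)=\ell(w')+\ell(v)$, and $p$ has an occurrence in consecutive positions of $w'$. A set of values $\{i_1,\dots,i_k\}$ forms a *value-stable occurrence of $p$ in $w$* if it is the set of values of such an occurrence in consecutive positions of such a $w'$, and these values also form an occurrence of $p$ in $w$. **Elnitsky polygons.** Fix vectors $d_1,\dots,d_n\in\mathbb R^2$ that point strictly downwards and whose directions turn strictly counterclockwise (for instance, of equal length). For a point $a$ and a word $u_1\cdots u_k$ of distinct labels in $\{1,\dots,n\}$, the Elnitsky polygon with top $a$ and this word is the closed region between its right border, the path from $a$ with successive edges $d_{u_1},\dots,d_{u_k}$, and its left border, the path from $a$ whose edges are the same vectors in increasing order of label; the two borders may touch, so (parts of) the polygon may degenerate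 to segments. Its edges are labeled by $\{u_1,\dots,u_k\}$. It is an $X(p)$-polygon if $u_1\cdots u_k$ is in the same relative order as $p(1)\cdots p(k)$. Elnitsky's polygon $X(w)$ is the one with top $0$ and word $w(1)\cdots w(n)$. A rhombus is an $X(21)$-polygon. **Paw tilings.** A *paw tiling* of $X(w)$ is a finite set of such Elnitsky polygons (*paws*) contained in $X(w)$ that, together with the border of $X(w)$, cover $X(w)$, such that no paw meets the interior of another paw, and such that the tiling is edge-to-edge (no vertex of a paw or of $X(w)$ lies in the relative interior of an edge of a paw or of $X(w)$). A paw $P$ in a paw tiling of $X(w)$ is *isolated* if, in every paw tiling of $X(w)$ that contains $P$ and whose other paws are all rhombi, no rhombus other than $P$ shares two edges with the right border of $P$. **Statement.** Let $w\in\mathfrak S_n$, $p\in\mathfrak S_k$ and $I=\{i_1,\dots,i_k\}\subseteq\{1,\dots,n\}$. There is a paw tiling of $X(w)$ that contains an isolated $X(p)$-paw with edges labeled by $I$ if and only if $(p,w)$ is value-stable and the values $i_1,\dots,i_k$ form a value-stable occurrence of $p$ in $w$. -/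

import Mathlib

/-! ### Permutations, length, patterns -/

/-- `s` is one of the adjacent transpositions `σ_i = (i, i+1)`. -/
def IsAdjacentTransposition {n : ℕ} (s : Equiv.Perm (Fin n)) : Prop :=
  ∃ i j : Fin n, (j : ℕ) = (i : ℕ) + 1 ∧ s = Equiv.swap i j

/-- The length `ℓ(w)`: the least number of adjacent transpositions whose product is `w`. -/
noncomputable def permLength {n : ℕ} (w : Equiv.Perm (Fin n)) : ℕ :=
  sInf {m : ℕ | ∃ s : List (Equiv.Perm (Fin n)),
    (∀ t ∈ s, IsAdjacentTransposition t) ∧ s.length = m ∧ s.prod = w}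

/-- `w(ι 0) ⋯ w(ι (k-1))` is an occurrence of the pattern `p` in `w`; the positions are
increasing because `ι` is an order embedding. -/
def IsOccurrenceAt {n k : ℕ} (p : Equiv.Perm (Fin k)) (w : Equiv.Perm (Fin n))
    (ι : Fin k ↪o Fin n) : Prop :=
  ∀ a b : Fin k, p a < p b ↔ w (ι a) < w (ι b)

/-- The set of values `{w(ι 0), …, w(ι (k-1))}`. -/
def valuesAt {n k : ℕ} (w : Equiv.Perm (Fin n)) (ι : Fin k ↪o Fin n) : Finset (Fin n) :=
  Finset.univ.image fun a => w (ι a)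

/-- The positions `ι 0 < ⋯ < ι (k-1)` are consecutive. -/
def ConsecutivePositions {n k : ℕ} (ι : Fin k ↪o Fin n) : Prop :=
  ∃ x : ℕ, ∀ a : Fin k, (ι a : ℕ) = x + (a : ℕ)

/-- `w = w' v` with `ℓ(w) = ℓ(w') + ℓ(v)`. -/
def IsReducedProduct {n : ℕ} (w w' v : Equiv.Perm (Fin n)) : Prop :=
  w = w' * v ∧ permLength w = permLength w' + permLength v

/-- `(p, w)` is a value-stable pair. -/
def ValueStable {n k : ℕ} (p : Equiv.Perm (Fin k)) (w : Equiv.Perm (Fin n)) : Prop :=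
  ∃ w' v : Equiv.Perm (Fin n), IsReducedProduct w w' v ∧
    ∃ ι : Fin k ↪o Fin n, IsOccurrenceAt p w' ι ∧ ConsecutivePositions ι

/-- `I` is the set of values of an occurrence of `p` in `w`. -/
def IsOccurrence {n k : ℕ} (p : Equiv.Perm (Fin k)) (w : Equiv.Perm (Fin n))
    (I : Finset (Fin n)) : Prop :=
  ∃ ι : Fin k ↪o Fin n, IsOccurrenceAt p w ι ∧ valuesAt w ι = I

/-- The values `I` form a value-stable occurrence of `p` in `w`: they form an occurrence of `p`
in `w`, and they are the values of a consecutively positioned `p`-pattern in some `w'` that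
witnesses that `(p, w)` is value-stable. -/
def IsValueStableOccurrence {n k : ℕ} (p : Equiv.Perm (Fin k)) (w : Equiv.Perm (Fin n))
    (I : Finset (Fin n)) : Prop :=
  IsOccurrence p w I ∧
    ∃ w' v : Equiv.Perm (Fin n), IsReducedProduct w w' v ∧
      ∃ ι : Fin k ↪o Fin n, IsOccurrenceAt p w' ι ∧ ConsecutivePositions ι ∧ valuesAt w' ι = I

/-! ### Elnitsky polygons in the plane -/

/-- `d i` is the edge vector of the sides labelled `i`. All of them point downwards, and the
directions turn strictly counterclockwise: the path with successive edges `d 0, d 1, …` is a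
convex left border running from the highest to the lowest vertex, and sides are parallel if and
only if they have the same label. Equal lengths are allowed but not required. -/
def IsEdgeSystem {n : ℕ} (d : Fin n → ℝ × ℝ) : Prop :=
  (∀ i, (d i).2 < 0) ∧ ∀ i j, i < j → 0 < (d i).1 * (d j).2 - (d j).1 * (d i).2

/-- An Elnitsky polygon with side labels in `Fin n`, given by its highest vertex and the labels
of its right border, read from top to bottom. Its left border carries the same labels in
increasing order. -/
@[ext]
structure ElnitskyPolygon (n : ℕ) where
  top : ℝ × ℝ
  word : List (Fin n)
  nodup : word.Nodup

/-- The edges (upper endpoint and label) of the path that starts at a point and whose successive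
edges carry the given labels. -/
def pathEdges {n : ℕ} (d : Fin n → ℝ × ℝ) : ℝ × ℝ → List (Fin n) → List ((ℝ × ℝ) × Fin n)
  | _, [] => []
  | a, i :: L => (a, i) :: pathEdges d (a + d i) L

/-- The vertices of that path. -/
def pathVertices {n : ℕ} (d : Fin n → ℝ × ℝ) : ℝ × ℝ → List (Fin n) → List (ℝ × ℝ)
  | a, [] => [a]
  | a, i :: L => a :: pathVertices d (a + d i) L

/-- The points of that path. -/
def pathPoints {n : ℕ} (d : Fin n → ℝ × ℝ) : ℝ × ℝ → List (Fin n) → Set (ℝ × ℝ)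
  | a, [] => {a}
  | a, i :: L => segment ℝ a (a + d i) ∪ pathPoints d (a + d i) L

namespace ElnitskyPolygon

variable {n : ℕ}

/-- The set of labels of the sides. -/
def labels (P : ElnitskyPolygon n) : Finset (Fin n) := P.word.toFinset

/-- The labels of the left border from top to bottom. -/
def leftWord (P : ElnitskyPolygon n) : List (Fin n) := P.labels.sort (· ≤ ·)

def rightEdges (d : Fin n → ℝ × ℝ) (P : ElnitskyPolygon n) : List ((ℝ × ℝ) × Fin n) :=
  pathEdges d P.top P.word

def leftEdges (d : Fin n → ℝ × ℝ) (P : ElnitskyPolygon n) : List ((ℝ × ℝ) × Fin n) :=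
  pathEdges d P.top P.leftWord

def edges (d : Fin n → ℝ × ℝ) (P : ElnitskyPolygon n) : List ((ℝ × ℝ) × Fin n) :=
  P.leftEdges d ++ P.rightEdges d

def vertices (d : Fin n → ℝ × ℝ) (P : ElnitskyPolygon n) : List (ℝ × ℝ) :=
  pathVertices d P.top P.leftWord ++ pathVertices d P.top P.word

def leftBorder (d : Fin n → ℝ × ℝ) (P : ElnitskyPolygon n) : Set (ℝ × ℝ) :=
  pathPoints d P.top P.leftWord

def rightBorder (d : Fin n → ℝ × ℝ) (P : ElnitskyPolygon n) : Set (ℝ × ℝ) :=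
  pathPoints d P.top P.word

/-- The closed region between the left and the right border. (The borders may touch.) -/
def region (d : Fin n → ℝ × ℝ) (P : ElnitskyPolygon n) : Set (ℝ × ℝ) :=
  {q | ∃ x₁ x₂ : ℝ, x₁ ≤ q.1 ∧ q.1 ≤ x₂ ∧
    (x₁, q.2) ∈ P.leftBorder d ∧ (x₂, q.2) ∈ P.rightBorder d}

/-- `P` is an `X(p)`-polygon: the string of labels of its right border is isomorphic to the
one-line notation of `p`. -/
def HasShape {k : ℕ} (P : ElnitskyPolygon n) (p : Equiv.Perm (Fin k)) : Prop :=
  ∃ h : P.word.length = k, ∀ a b : Fin k,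
    p a < p b ↔ P.word.get (a.cast h.symm) < P.word.get (b.cast h.symm)

/-- A rhombus is an `X(21)`-polygon. -/
def IsRhombus (P : ElnitskyPolygon n) : Prop :=
  P.HasShape (Equiv.swap (0 : Fin 2) 1)

end ElnitskyPolygon

/-- Elnitsky's polygon `X(w)`, with its highest vertex at the origin. -/
def elnitskyX {n : ℕ} (w : Equiv.Perm (Fin n)) : ElnitskyPolygon n where
  top := 0
  word := List.ofFn w
  nodup := List.nodup_ofFn.mpr w.injective

/-! ### Paw tilings -/

/-- `T` is a paw tiling of `X(w)`. Parts of `X(w)` or of a paw may degenerate to line segments: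
the former need not be covered by paws, and the latter must stay out of the interiors of the
other paws. The tiling is edge-to-edge. -/
structure IsPawTiling {n : ℕ} (d : Fin n → ℝ × ℝ) (w : Equiv.Perm (Fin n))
    (T : Set (ElnitskyPolygon n)) : Prop where
  finite : T.Finite
  subset : ∀ P ∈ T, P.region d ⊆ (elnitskyX w).region d
  cover : (elnitskyX w).region d ⊆
    ((elnitskyX w).leftBorder d ∪ (elnitskyX w).rightBorder d) ∪ ⋃ P ∈ T, P.region d
  nonoverlapping : ∀ P ∈ T, ∀ Q ∈ T, P ≠ Q → Disjoint (P.region d) (interior (Q.region d))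
  edge_to_edge : ∀ P ∈ insert (elnitskyX w) T, ∀ Q ∈ insert (elnitskyX w) T,
    ∀ x ∈ P.vertices d, ∀ e ∈ Q.edges d, x ∉ openSegment ℝ e.1 (e.1 + d e.2)

/-- The paw tilings of `X(w)` that contain the paw `P` and tile the rest of `X(w)` by rhombi. -/
def rhombicCompletions {n : ℕ} (d : Fin n → ℝ × ℝ) (w : Equiv.Perm (Fin n))
    (P : ElnitskyPolygon n) : Set (Set (ElnitskyPolygon n)) :=
  {T | IsPawTiling d w T ∧ P ∈ T ∧ ∀ Q ∈ T, Q ≠ P → Q.IsRhombus}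

/-- Two different edges of `Q` are edges of the right border of `P`. -/
def SharesTwoRightEdges {n : ℕ} (d : Fin n → ℝ × ℝ) (Q P : ElnitskyPolygon n) : Prop :=
  ∃ e₁ ∈ Q.edges d, ∃ e₂ ∈ Q.edges d, e₁ ≠ e₂ ∧ e₁ ∈ P.rightEdges d ∧ e₂ ∈ P.rightEdges d

/-- The paw `P` of the paw tiling `T` of `X(w)` is isolated in `T`. -/
def IsIsolatedPaw {n : ℕ} (d : Fin n → ℝ × ℝ) (w : Equiv.Perm (Fin n))
    (T : Set (ElnitskyPolygon n)) (P : ElnitskyPolygon n) : Prop :=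
  IsPawTiling d w T ∧ P ∈ T ∧
    ∀ S ∈ rhombicCompletions d w P, ∀ Q ∈ S, Q ≠ P → Q.IsRhombus → ¬ SharesTwoRightEdges d Q P

/-!
Paths with the same top and the same edge labels are ordered from left to right exactly as their
words are ordered by inclusion of inversions, since the slope of an edge increases with its label.
Adding an inversion to a word by an adjacent swap replaces the left border of a rhombus in its path
by the right border, so a saturated chain of words sweeps out a tiling by rhombi. In particular, a
chain through `α ++ P.leftWord ++ β` and `α ++ P.word ++ β`, both below `w`, gives a paw tiling
that contains `P`.

Conversely, cut the paws of a paw tiling into rhombi. The midlines of these rhombi and the right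
border of a paw `P` are disjoint curves, one of which is leftmost. If this is the midline of a
rhombus, then the left border of the rhombus lies on the left border of the tiled region, and the
rhombus can be removed. Once it is the right border of `P`, the left border of the remaining region
is the path of a word `α ++ P.word ++ β` below `w`.

A rhombus that shares two edges with the right border of `P` swaps adjacent letters `i < j` of
`P.word`, so there is one in some tiling exactly when such a pair is an inversion of `w`. Hence `P`
is isolated if and only if `P.word` is a subword of `w`.
-/

/-! ### The weak order on words -/

section WeakOrder

variable {α : Type*}

theorem pair_sublist_cons {a b c : α} {L : List α} :
    [a, b].Sublist (c :: L) ↔ (a = c ∧ b ∈ L) ∨ [a, b].Sublist L := by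
  rw [List.cons_sublist_cons', List.singleton_sublist, or_comm]

theorem pair_sublist_append {a b : α} {L M : List α} :
    [a, b].Sublist (L ++ M) ↔ [a, b].Sublist L ∨ (a ∈ L ∧ b ∈ M) ∨ [a, b].Sublist M := by
  induction L with
  | nil => simp
  | cons c L ih =>
    simp only [List.cons_append, pair_sublist_cons, ih, List.mem_append, List.mem_cons]
    tauto

theorem mem_of_pair_sublist {a b : α} {L : List α} (h : [a, b].Sublist L) : a ∈ L ∧ b ∈ L :=
  ⟨h.subset (by simp), h.subset (by simp)⟩

theorem pair_sublist_total {a b : α} {L : List α} (hab : a ≠ b) (ha : a ∈ L) (hb : b ∈ L) :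
    [a, b].Sublist L ∨ [b, a].Sublist L := by
  induction L with
  | nil => simp at ha
  | cons c L ih =>
    simp only [pair_sublist_cons, List.mem_cons] at *
    grind

theorem pair_sublist_asymm {a b : α} {L : List α} (hL : L.Nodup) (hab : [a, b].Sublist L) :
    ¬ [b, a].Sublist L := by
  induction L with
  | nil => simp
  | cons c L ih =>
    rw [List.nodup_cons] at hL
    have hmem : ∀ {x y}, [x, y].Sublist L → x ∈ L ∧ y ∈ L := mem_of_pair_sublist
    simp only [pair_sublist_cons] at *
    grind

theorem pair_sublist_ne {a b : α} {L : List α} (hL : L.Nodup) (hab : [a, b].Sublist L) :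
    a ≠ b := by
  rintro rfl
  exact pair_sublist_asymm hL hab hab

theorem pair_sublist_trans {a b c : α} {L : List α} (hL : L.Nodup) (hab : [a, b].Sublist L)
    (hbc : [b, c].Sublist L) : [a, c].Sublist L := by
  induction L with
  | nil => simp at hab
  | cons x L ih =>
    rw [List.nodup_cons] at hL
    have hmem : ∀ {x y}, [x, y].Sublist L → x ∈ L ∧ y ∈ L := mem_of_pair_sublist
    simp only [pair_sublist_cons] at *
    grind

theorem pairwise_pair_sublist_self (L : List α) : L.Pairwise fun a b => [a, b].Sublist L :=
  List.pairwise_iff_forall_sublist.2 fun h => h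

theorem pairwise_pair_sublist_of_adjacent {L L' : List α} (hL' : L'.Nodup)
    (h : ∀ A a b B, L = A ++ a :: b :: B → [a, b].Sublist L') :
    L.Pairwise fun a b => [a, b].Sublist L' := by
  have : Trans (fun a b => [a, b].Sublist L') (fun a b => [a, b].Sublist L')
      (fun a b => [a, b].Sublist L') := ⟨fun h1 h2 => pair_sublist_trans hL' h1 h2⟩
  rw [← List.isChain_iff_pairwise, List.isChain_iff_forall_rel_of_append_cons_cons]
  exact fun a b A B hAB => h A a b B hAB

theorem sublist_of_pairwise_pair_sublist {L L' : List α} (hL' : L'.Nodup) (hL : L.Nodup)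
    (hsub : L ⊆ L') (h : L.Pairwise fun a b => [a, b].Sublist L') : L.Sublist L' := by
  have : Std.Antisymm fun a b : α => [a, b].Sublist L' :=
    ⟨fun _ _ hab hba => absurd hba (pair_sublist_asymm hL' hab)⟩
  exact List.sublist_of_subperm_of_pairwise (hL.subperm hsub) h (pairwise_pair_sublist_self L')

theorem perm_swap_middle (A B : List α) (a b : α) :
    (A ++ a :: b :: B).Perm (A ++ b :: a :: B) :=
  (List.Perm.swap b a B).append_left A

variable [LinearOrder α]

/-- The weak order on words with the same letters: every inversion of `L` is an inversion of
`L'`. -/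
def WeakLE (L L' : List α) : Prop :=
  ∀ a b, a < b → [b, a].Sublist L → [b, a].Sublist L'

namespace WeakLE

variable {L L' M : List α}

theorem refl (L : List α) : WeakLE L L := fun _ _ _ h => h

theorem trans (h : WeakLE L L') (h' : WeakLE L' M) : WeakLE L M :=
  fun a b hab hba => h' a b hab (h a b hab hba)

theorem of_sorted (h : L.Pairwise (· ≤ ·)) : WeakLE L L' :=
  fun _ _ hab hba => absurd (List.pairwise_iff_forall_sublist.1 h hba) (not_le.2 hab)

theorem append_append (h : WeakLE L L') (hp : L.Perm L') (A B : List α) :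
    WeakLE (A ++ L ++ B) (A ++ L' ++ B) := by
  intro a b hab
  simp only [pair_sublist_append, List.mem_append, hp.mem_iff]
  have := h a b hab
  tauto

theorem swap_ascent (A B : List α) {a b : α} (hab : a < b) :
    WeakLE (A ++ a :: b :: B) (A ++ b :: a :: B) := by
  have h : WeakLE [a, b] [b, a] := of_sorted (by simp [hab.le])
  simpa using h.append_append (List.Perm.swap b a []) A B

theorem swap_of_pair_sublist {A B : List α} {a b : α} (h : WeakLE (A ++ a :: b :: B) L')
    (hba : [b, a].Sublist L') : WeakLE (A ++ b :: a :: B) L' := by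
  intro x y hxy hs
  have hle := h x y hxy
  simp only [pair_sublist_append, pair_sublist_cons, List.mem_cons] at hs hle
  grind

theorem exists_ascent (h : WeakLE L L') (hL' : L'.Nodup) (hp : L.Perm L') (hne : L ≠ L') :
    ∃ A a b B, L = A ++ a :: b :: B ∧ a < b ∧ [b, a].Sublist L' := by
  by_contra! hcon
  refine hne (List.Sublist.eq_of_length (sublist_of_pairwise_pair_sublist hL'
    (hp.nodup_iff.2 hL') hp.subset (pairwise_pair_sublist_of_adjacent hL' ?_)) hp.length_eq)
  intro A a b B hL
  have hs : [a, b].Sublist L := by simp [hL]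
  have hab : a ≠ b := pair_sublist_ne (hp.nodup_iff.2 hL') hs
  rcases hab.lt_or_gt with hlt | hgt
  · obtain ⟨ha, hb⟩ := mem_of_pair_sublist hs
    exact (pair_sublist_total hab (hp.mem_iff.1 ha) (hp.mem_iff.1 hb)).resolve_right
      (hcon A a b B hL hlt)
  · exact h b a hgt hs

theorem induction_ascent (hL' : L'.Nodup) {C : List α → Prop} (top : C L')
    (swap : ∀ A a b B, a < b → WeakLE (A ++ b :: a :: B) L' → (A ++ b :: a :: B).Perm L' →
      C (A ++ b :: a :: B) → C (A ++ a :: b :: B))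
    (hp : L.Perm L') (h : WeakLE L L') : C L := by
  classical
  let missing (L : List α) : Finset (α × α) :=
    {x ∈ L'.toFinset ×ˢ L'.toFinset | x.1 < x.2 ∧ ¬ [x.2, x.1].Sublist L}
  induction hN : (missing L).card using Nat.strong_induction_on generalizing L with
  | _ m ih =>
    by_cases hne : L = L'
    · rwa [hne]
    obtain ⟨A, a, b, B, rfl, hab, hba⟩ := h.exists_ascent hL' hp hne
    have hp' := (perm_swap_middle A B a b).symm.trans hp
    have hle := h.swap_of_pair_sublist hba
    refine swap A a b B hab hle hp' (ih _ ?_ hp' hle rfl)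
    rw [← hN]
    refine Finset.card_lt_card ((Finset.ssubset_iff_of_subset fun x hx => ?_).2 ⟨(a, b), ?_, ?_⟩)
    · simp only [missing, Finset.mem_filter] at hx ⊢
      exact ⟨hx.1, hx.2.1, fun hs => hx.2.2 (swap_ascent A B hab x.1 x.2 hx.2.1 hs)⟩
    · have hsub : [a, b].Sublist (A ++ a :: b :: B) := by simp
      simp only [missing, Finset.mem_filter, Finset.mem_product, List.mem_toFinset]
      exact ⟨(mem_of_pair_sublist hba).symm, hab, pair_sublist_asymm (hp.nodup_iff.2 hL') hsub⟩
    · simp [missing]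

end WeakLE

end WeakOrder

/-! ### Length and reduced products -/

theorem apply_eq_getElem_of_ofFn_eq_append {α : Type*} {n : ℕ} {f : Fin n → α} {A u B : List α}
    (h : List.ofFn f = A ++ u ++ B) {a : ℕ} (ha : a < u.length) {i : Fin n}
    (hi : (i : ℕ) = A.length + a) : f i = u[a] := by
  have hget : (List.ofFn f)[(i : ℕ)]? = some (f i) := by simp
  rw [h, hi, List.append_assoc, List.getElem?_append_right (by omega), Nat.add_sub_cancel_left,
    List.getElem?_append_left ha, List.getElem?_eq_getElem ha] at hget
  exact (Option.some.inj hget).symm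

section Length

variable {n : ℕ} {w w' : Equiv.Perm (Fin n)}

theorem nodup_ofFn_perm (w : Equiv.Perm (Fin n)) : (List.ofFn w).Nodup :=
  List.nodup_ofFn.2 w.injective

theorem mem_ofFn_perm (w : Equiv.Perm (Fin n)) (a : Fin n) : a ∈ List.ofFn w :=
  List.mem_ofFn.2 (w.surjective a)

theorem ofFn_perm_ofFn (w w' : Equiv.Perm (Fin n)) : (List.ofFn w).Perm (List.ofFn w') :=
  (w.ofFn_comp_perm id).trans (w'.ofFn_comp_perm id).symm

theorem exists_ofFn_eq_of_perm {L : List (Fin n)} (h : L.Perm (List.ofFn w)) :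
    ∃ w' : Equiv.Perm (Fin n), List.ofFn w' = L := by
  have hlen : L.length = n := by simpa using h.length_eq
  have hinj : Function.Injective fun i : Fin n => L.get (i.cast hlen.symm) :=
    (List.nodup_iff_injective_get.1 (h.nodup_iff.2 (nodup_ofFn_perm w))).comp
      (Fin.cast_injective hlen.symm)
  refine ⟨Equiv.ofBijective _ (Finite.injective_iff_bijective.1 hinj), ?_⟩
  exact List.ext_get (by simp [hlen]) fun i _ _ => by simp

theorem pair_sublist_ofFn {a b : Fin n} : [a, b].Sublist (List.ofFn w) ↔ w⁻¹ a < w⁻¹ b := by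
  have hpw : (List.ofFn w).Pairwise fun a b => w⁻¹ a < w⁻¹ b := by
    rw [List.pairwise_ofFn]
    intro i j hij
    simpa using hij
  have lt_of_sublist : ∀ {a b : Fin n}, [a, b].Sublist (List.ofFn w) → w⁻¹ a < w⁻¹ b :=
    fun h => List.pairwise_iff_forall_sublist.1 hpw h
  refine ⟨lt_of_sublist, fun h => ?_⟩
  have hab : a ≠ b := by rintro rfl; exact lt_irrefl _ h
  exact (pair_sublist_total hab (mem_ofFn_perm w a) (mem_ofFn_perm w b)).resolve_right
    fun hba => lt_asymm h (lt_of_sublist hba)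

/-- The inversions of a permutation, as pairs of values. -/
def invPairs (w : Equiv.Perm (Fin n)) : Finset (Fin n × Fin n) :=
  Finset.univ.filter fun x => x.1 < x.2 ∧ w⁻¹ x.2 < w⁻¹ x.1

theorem mem_invPairs {a b : Fin n} : (a, b) ∈ invPairs w ↔ a < b ∧ w⁻¹ b < w⁻¹ a := by
  simp [invPairs]

theorem invPairs_one : invPairs (1 : Equiv.Perm (Fin n)) = ∅ := by
  ext ⟨a, b⟩
  simp only [mem_invPairs, inv_one, Equiv.Perm.one_apply, Finset.notMem_empty, iff_false]
  exact fun h => lt_asymm h.1 h.2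

theorem weakLE_ofFn_iff : WeakLE (List.ofFn w') (List.ofFn w) ↔ invPairs w' ⊆ invPairs w := by
  constructor
  · rintro h ⟨a, b⟩ hab
    rw [mem_invPairs] at hab ⊢
    exact ⟨hab.1, pair_sublist_ofFn.1 (h a b hab.1 (pair_sublist_ofFn.2 hab.2))⟩
  · intro h a b hab hs
    rw [pair_sublist_ofFn] at hs ⊢
    exact (mem_invPairs.1 (h (mem_invPairs.2 ⟨hab, hs⟩))).2

theorem swap_lt_swap_iff {i j x y : Fin n} (hij : (j : ℕ) = i + 1)
    (hxy : ¬ (x = i ∧ y = j)) (hyx : ¬ (x = j ∧ y = i)) :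
    Equiv.swap i j x < Equiv.swap i j y ↔ x < y := by
  simp only [Equiv.swap_apply_def]
  split_ifs <;> simp only [Fin.ext_iff, Fin.lt_def] at * <;> omega

theorem invPairs_mul_swap {i j : Fin n} (hij : (j : ℕ) = i + 1) (h : w i < w j) :
    invPairs (w * Equiv.swap i j) = insert (w i, w j) (invPairs w) ∧
      (invPairs (w * Equiv.swap i j)).card = (invPairs w).card + 1 := by
  have hlt : i < j := by rw [Fin.lt_def]; omega
  have hins : invPairs (w * Equiv.swap i j) = insert (w i, w j) (invPairs w) := by
    ext ⟨a, b⟩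
    simp only [mem_invPairs, Finset.mem_insert, Prod.mk.injEq, mul_inv_rev,
      Equiv.Perm.mul_apply, Equiv.swap_inv]
    by_cases hab : a = w i ∧ b = w j
    · obtain ⟨rfl, rfl⟩ := hab
      simp [h, hlt]
    by_cases hba : a = w j ∧ b = w i
    · obtain ⟨rfl, rfl⟩ := hba
      simp [h.le, h.ne, h.ne']
    rw [swap_lt_swap_iff hij (fun hx => hba ⟨by simp [← hx.2], by simp [← hx.1]⟩)
      (fun hx => hab ⟨by simp [← hx.2], by simp [← hx.1]⟩)]
    simp [hab]
  exact ⟨hins, by rw [hins, Finset.card_insert_of_notMem (by simp [mem_invPairs, h, hlt.le])]⟩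

theorem card_invPairs_mul_prod_le (w : Equiv.Perm (Fin n)) (l : List (Equiv.Perm (Fin n)))
    (hl : ∀ t ∈ l, IsAdjacentTransposition t) :
    (invPairs (w * l.prod)).card ≤ (invPairs w).card + l.length ∧
      ((invPairs (w * l.prod)).card = (invPairs w).card + l.length →
        invPairs w ⊆ invPairs (w * l.prod)) := by
  induction l generalizing w with
  | nil => simp
  | cons t l ih =>
    obtain ⟨i, j, hij, rfl⟩ := hl t (by simp)
    obtain ⟨hcard, hsub⟩ := ih (w * Equiv.swap i j) fun t ht => hl t (by simp [ht])
    have hne : i ≠ j := by rw [Ne, Fin.ext_iff]; omega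
    rw [List.prod_cons, ← mul_assoc, List.length_cons]
    rcases (w.injective.ne hne).lt_or_gt with h | h
    · obtain ⟨hins, hc⟩ := invPairs_mul_swap hij h
      exact ⟨by omega, fun he => (hins ▸ Finset.subset_insert _ _).trans (hsub (by omega))⟩
    · obtain ⟨-, hc⟩ := invPairs_mul_swap (w := w * Equiv.swap i j) hij (by simpa using h)
      rw [mul_assoc, Equiv.swap_mul_self, mul_one] at hc
      exact ⟨by omega, fun he => by omega⟩

theorem exists_adjacent_of_invPairs_subset (h : invPairs w' ⊆ invPairs w) (hne : w' ≠ w) :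
    ∃ i j : Fin n, (j : ℕ) = i + 1 ∧ w' i < w' j ∧ (w' i, w' j) ∈ invPairs w := by
  obtain ⟨A, a, b, B, hL, hab, hba⟩ := (weakLE_ofFn_iff.2 h).exists_ascent (nodup_ofFn_perm w)
    (ofFn_perm_ofFn w' w) fun h => hne (DFunLike.coe_injective (List.ofFn_injective h))
  have hlen := congrArg List.length hL
  simp only [List.length_ofFn, List.length_append, List.length_cons] at hlen
  have hL' : List.ofFn w' = A ++ [a, b] ++ B := by simpa using hL
  have ha := apply_eq_getElem_of_ofFn_eq_append hL' (a := 0) (by simp)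
    (i := ⟨A.length, by omega⟩) rfl
  have hb := apply_eq_getElem_of_ofFn_eq_append hL' (a := 1) (by simp)
    (i := ⟨A.length + 1, by omega⟩) rfl
  refine ⟨⟨A.length, by omega⟩, ⟨A.length + 1, by omega⟩, rfl, ?_⟩
  rw [ha, hb]
  exact ⟨hab, mem_invPairs.2 ⟨hab, pair_sublist_ofFn.1 hba⟩⟩

theorem exists_adjacent_factorization (h : invPairs w' ⊆ invPairs w) :
    ∃ l : List (Equiv.Perm (Fin n)), (∀ t ∈ l, IsAdjacentTransposition t) ∧ w' * l.prod = w ∧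
      (invPairs w).card = (invPairs w').card + l.length := by
  induction hN : (invPairs w).card - (invPairs w').card using Nat.strong_induction_on
    generalizing w' with
  | _ N ih =>
    by_cases hne : w' = w
    · exact ⟨[], by simp, by simp [hne], by simp [hne]⟩
    obtain ⟨i, j, hij, hlt, hmem⟩ := exists_adjacent_of_invPairs_subset h hne
    obtain ⟨hins, hc⟩ := invPairs_mul_swap hij hlt
    have hsub : invPairs (w' * Equiv.swap i j) ⊆ invPairs w := by
      rw [hins]; exact Finset.insert_subset hmem h
    have hle := Finset.card_le_card hsub
    obtain ⟨l, hl, hprod, hcard⟩ := ih _ (by omega) hsub rfl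
    refine ⟨Equiv.swap i j :: l, ?_, by rw [List.prod_cons, ← mul_assoc, hprod],
      by rw [List.length_cons]; omega⟩
    exact List.forall_mem_cons.2 ⟨⟨i, j, hij, rfl⟩, hl⟩

theorem permLength_prod_le {l : List (Equiv.Perm (Fin n))}
    (hl : ∀ t ∈ l, IsAdjacentTransposition t) : permLength l.prod ≤ l.length :=
  Nat.sInf_le ⟨l, hl, rfl, rfl⟩

theorem exists_reduced_word (w : Equiv.Perm (Fin n)) :
    ∃ l : List (Equiv.Perm (Fin n)), (∀ t ∈ l, IsAdjacentTransposition t) ∧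
      l.length = permLength w ∧ l.prod = w := by
  obtain ⟨l, hl, hprod, -⟩ := exists_adjacent_factorization (w := w) (w' := 1)
    (by rw [invPairs_one]; exact Finset.empty_subset _)
  exact Nat.sInf_mem (s := {m : ℕ | ∃ s : List (Equiv.Perm (Fin n)),
    (∀ t ∈ s, IsAdjacentTransposition t) ∧ s.length = m ∧ s.prod = w})
    ⟨_, l, hl, rfl, by simpa using hprod⟩

theorem permLength_eq_card_invPairs (w : Equiv.Perm (Fin n)) :
    permLength w = (invPairs w).card := by
  apply le_antisymm
  · obtain ⟨l, hl, rfl, hcard⟩ := exists_adjacent_factorization (w := w) (w' := 1)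
      (by rw [invPairs_one]; exact Finset.empty_subset _)
    rw [one_mul] at hcard ⊢
    simpa [hcard, invPairs_one] using permLength_prod_le hl
  · obtain ⟨l, hl, hlen, rfl⟩ := exists_reduced_word w
    simpa [invPairs_one, hlen] using (card_invPairs_mul_prod_le 1 l hl).1

theorem exists_isReducedProduct_iff_weakLE :
    (∃ v, IsReducedProduct w w' v) ↔ WeakLE (List.ofFn w') (List.ofFn w) := by
  simp only [weakLE_ofFn_iff, IsReducedProduct, permLength_eq_card_invPairs]
  constructor
  · rintro ⟨v, rfl, hcard⟩
    obtain ⟨l, hl, hlen, rfl⟩ := exists_reduced_word v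
    exact (card_invPairs_mul_prod_le w' l hl).2
      (by rw [hcard, ← permLength_eq_card_invPairs l.prod, hlen])
  · intro h
    obtain ⟨l, hl, hprod, hcard⟩ := exists_adjacent_factorization h
    refine ⟨l.prod, hprod.symm, le_antisymm ?_ ?_⟩
    · obtain ⟨m, hm, hlen, hmprod⟩ := exists_reduced_word l.prod
      have hle := (card_invPairs_mul_prod_le w' m hm).1
      rwa [hmprod, hprod, hlen, permLength_eq_card_invPairs] at hle
    · have hle := permLength_prod_le hl
      rw [permLength_eq_card_invPairs] at hle
      omega

end Length

section StableFactor

variable {n k : ℕ} {w : Equiv.Perm (Fin n)} {p : Equiv.Perm (Fin k)}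

/-- The word `u` is a factor of the one-line notation of some `w'` that lies below `w` in the weak
order, and it is also a subsequence of the one-line notation of `w`. These are the words of the
value-stable occurrences in `w`. -/
def IsStableFactor (w : Equiv.Perm (Fin n)) (u : List (Fin n)) : Prop :=
  u.Sublist (List.ofFn w) ∧ ∃ A B : List (Fin n),
    (A ++ u ++ B).Perm (List.ofFn w) ∧ WeakLE (A ++ u ++ B) (List.ofFn w)

theorem exists_consecutivePositions_iff {α : Type*} {f : Fin n → α} {g : Fin k → α} :
    (∃ ι : Fin k ↪o Fin n, ConsecutivePositions ι ∧ ∀ a, f (ι a) = g a) ↔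
      ∃ A B, List.ofFn f = A ++ List.ofFn g ++ B := by
  constructor
  · rintro ⟨ι, ⟨x, hx⟩, hfg⟩
    have hfactor : ((List.ofFn f).drop x).take k = List.ofFn g := by
      refine List.ext_getElem ?_ fun a _ ha => ?_
      · rcases k.eq_zero_or_pos with rfl | hk
        · simp
        · have hlast := hx ⟨k - 1, by omega⟩
          have := (ι ⟨k - 1, by omega⟩).2
          simp only [List.length_take, List.length_drop, List.length_ofFn]
          simp only at hlast
          omega
      · rw [List.length_ofFn] at ha
        simp only [List.getElem_take, List.getElem_drop, List.getElem_ofFn, ← hfg]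
        exact congrArg f (Fin.ext (hx ⟨a, ha⟩).symm)
    refine ⟨(List.ofFn f).take x, ((List.ofFn f).drop x).drop k, ?_⟩
    rw [← hfactor, List.append_assoc, List.take_append_drop, List.take_append_drop]
  · rintro ⟨A, B, h⟩
    have hlen : A.length + k + B.length = n := by
      simpa [add_assoc] using (congrArg List.length h).symm
    refine ⟨OrderEmbedding.ofStrictMono (fun a => ⟨A.length + a, by omega⟩)
      fun a b hab => Nat.add_lt_add_left hab _, ⟨A.length, fun _ => rfl⟩, fun a => ?_⟩
    rw [apply_eq_getElem_of_ofFn_eq_append h (a := a) (by simp) rfl, List.getElem_ofFn]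

theorem exists_apply_eq_iff_sublist {f : Fin k → Fin n} :
    (∃ κ : Fin k ↪o Fin n, ∀ a, w (κ a) = f a) ↔ (List.ofFn f).Sublist (List.ofFn w) := by
  constructor
  · rintro ⟨κ, hκ⟩
    obtain rfl : (fun a => w (κ a)) = f := funext hκ
    refine sublist_of_pairwise_pair_sublist (nodup_ofFn_perm w)
      (List.nodup_ofFn.2 (w.injective.comp κ.injective)) (fun a _ => mem_ofFn_perm w a) ?_
    rw [List.pairwise_ofFn]
    exact fun a b hab => pair_sublist_ofFn.2 (by simpa using hab)
  · intro h
    have hmono : StrictMono fun a => w⁻¹ (f a) := fun a b hab => pair_sublist_ofFn.1 <|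
      (List.pairwise_ofFn.1 (pairwise_pair_sublist_self (List.ofFn f)) hab).trans h
    exact ⟨OrderEmbedding.ofStrictMono _ hmono, fun a => by simp⟩

theorem eq_of_pattern_eq {α : Type*} [LinearOrder α] {f g : Fin k → α}
    (hf : ∀ a b, p a < p b ↔ f a < f b) (hg : ∀ a b, p a < p b ↔ g a < g b)
    (h : Set.range f = Set.range g) : f = g := by
  have hf' : StrictMono (f ∘ p.symm) := fun a b hab => (hf _ _).1 (by simpa using hab)
  have hg' : StrictMono (g ∘ p.symm) := fun a b hab => (hg _ _).1 (by simpa using hab)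
  have heq : f ∘ p.symm = g ∘ p.symm := (hf'.range_inj hg').1 (by
    rw [p.symm.surjective.range_comp, p.symm.surjective.range_comp, h])
  exact p.symm.surjective.injective_comp_right heq

theorem isValueStableOccurrence_iff {I : Finset (Fin n)} :
    IsValueStableOccurrence p w I ↔ ∃ f : Fin k → Fin n, (∀ a b, p a < p b ↔ f a < f b) ∧
      Finset.univ.image f = I ∧ IsStableFactor w (List.ofFn f) := by
  constructor
  · rintro ⟨⟨κ, hκ, hκI⟩, w', v, hv, ι, hι, hcons, rfl⟩
    have hfg : (fun a => w (κ a)) = fun a => w' (ι a) := by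
      refine eq_of_pattern_eq hκ hι ?_
      simpa [valuesAt] using congrArg (fun s : Finset (Fin n) => (s : Set (Fin n))) hκI
    obtain ⟨A, B, hAB⟩ := exists_consecutivePositions_iff.1 ⟨ι, hcons, fun _ => rfl⟩
    refine ⟨fun a => w' (ι a), hι, rfl,
      exists_apply_eq_iff_sublist.1 ⟨κ, congrFun hfg⟩, A, B, ?_⟩
    rw [← hAB]
    exact ⟨ofFn_perm_ofFn w' w, exists_isReducedProduct_iff_weakLE.1 ⟨v, hv⟩⟩
  · rintro ⟨f, hpat, rfl, hsub, A, B, hperm, hle⟩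
    obtain ⟨κ, hκ⟩ := exists_apply_eq_iff_sublist.2 hsub
    obtain ⟨w', hw'⟩ := exists_ofFn_eq_of_perm hperm
    obtain ⟨v, hv⟩ := exists_isReducedProduct_iff_weakLE.2 (hw' ▸ hle)
    obtain ⟨ι, hcons, hι⟩ := exists_consecutivePositions_iff.2 ⟨A, B, hw'⟩
    refine ⟨⟨κ, ?_, ?_⟩, w', v, hv, ι, ?_, hcons, ?_⟩ <;>
      simp only [IsOccurrenceAt, valuesAt, hκ, hι, hpat, implies_true]

theorem IsValueStableOccurrence.valueStable {I : Finset (Fin n)}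
    (h : IsValueStableOccurrence p w I) : ValueStable p w := by
  obtain ⟨-, w', v, hv, ι, hocc, hcons, -⟩ := h
  exact ⟨w', v, hv, ι, hocc, hcons⟩

end StableFactor

/-! ### Paths as graphs over the height -/

section Path

variable {n : ℕ} (d : Fin n → ℝ × ℝ)

/-- The vertical extent of an edge with label `i`. -/
def edgeHeight (i : Fin n) : ℝ := -(d i).2

/-- The horizontal displacement of an edge with label `i` per unit of depth. -/
noncomputable def edgeSlope (i : Fin n) : ℝ := (d i).1 / edgeHeight d i

/-- The sum of the edge vectors of a word, which leads from the top of its path to the bottom. -/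
def wordSum (L : List (Fin n)) : ℝ × ℝ := (L.map d).sum

/-- The vertical extent of the path of a word. -/
def wordHeight (L : List (Fin n)) : ℝ := (L.map (edgeHeight d)).sum

/-- The value, at depth `t` below the top of the path of a word, of the piecewise linear function
that vanishes at the top and grows at rate `c i` along the edge labelled `i`. It is constant above
the top and below the bottom of the path. -/
noncomputable def accum (c : Fin n → ℝ) : List (Fin n) → ℝ → ℝ
  | [], _ => 0
  | i :: L, t => c i * max 0 (min t (edgeHeight d i)) + accum c L (t - edgeHeight d i)

/-- The vertical extent of the part of the edge labelled `l` that the path of a word has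
traversed at depth `t` below its top. -/
noncomputable def usedHeight (L : List (Fin n)) (t : ℝ) (l : Fin n) : ℝ :=
  accum d (Pi.single l 1) L t

/-- The abscissa at height `y` of the path of the word `L` with top `a`. -/
noncomputable def pathX (a : ℝ × ℝ) (L : List (Fin n)) (y : ℝ) : ℝ :=
  a.1 + accum d (edgeSlope d) L (a.2 - y)

variable {d}

theorem wordSum_append (L M : List (Fin n)) :
    wordSum d (L ++ M) = wordSum d L + wordSum d M := by simp [wordSum]

theorem wordHeight_cons (i : Fin n) (L : List (Fin n)) :
    wordHeight d (i :: L) = edgeHeight d i + wordHeight d L := by simp [wordHeight]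

theorem wordHeight_append (L M : List (Fin n)) :
    wordHeight d (L ++ M) = wordHeight d L + wordHeight d M := by simp [wordHeight]

theorem wordHeight_perm {L M : List (Fin n)} (h : L.Perm M) : wordHeight d L = wordHeight d M :=
  (h.map _).sum_eq

theorem wordSum_perm {L M : List (Fin n)} (h : L.Perm M) : wordSum d L = wordSum d M :=
  (h.map _).sum_eq

theorem add_wordSum_cons (a : ℝ × ℝ) (i : Fin n) (L : List (Fin n)) :
    a + wordSum d (i :: L) = a + d i + wordSum d L := by simp [wordSum, add_assoc]

theorem add_wordSum_nil (a : ℝ × ℝ) : a + wordSum d [] = a := add_zero a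

theorem add_wordSum_snd (a : ℝ × ℝ) (L : List (Fin n)) :
    (a + wordSum d L).2 = a.2 - wordHeight d L := by
  induction L generalizing a with
  | nil => simp [wordSum, wordHeight]
  | cons i L ih =>
    have := ih (a + d i)
    simp only [wordSum, wordHeight, edgeHeight, List.map_cons, List.sum_cons, Prod.snd_add] at *
    linarith

theorem continuous_accum (c : Fin n → ℝ) (L : List (Fin n)) : Continuous (accum d c L) := by
  induction L with
  | nil => exact continuous_const
  | cons i L ih =>
    simp only [accum]
    fun_prop

theorem continuous_pathX (a : ℝ × ℝ) (L : List (Fin n)) : Continuous (pathX d a L) := by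
  have := continuous_accum (d := d) (edgeSlope d) L
  unfold pathX
  fun_prop

theorem accum_append (c : Fin n → ℝ) (L M : List (Fin n)) (t : ℝ) :
    accum d c (L ++ M) t = accum d c L t + accum d c M (t - wordHeight d L) := by
  induction L generalizing t with
  | nil => simp [accum, wordHeight]
  | cons i L ih => simp only [List.cons_append, accum, ih, wordHeight_cons, sub_sub, add_assoc]

theorem usedHeight_cons_self (i : Fin n) (L : List (Fin n)) (t : ℝ) :
    usedHeight d (i :: L) t i =
      max 0 (min t (edgeHeight d i)) + usedHeight d L (t - edgeHeight d i) i := by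
  simp [usedHeight, accum]

theorem usedHeight_cons_of_ne {i l : Fin n} (h : l ≠ i) (L : List (Fin n)) (t : ℝ) :
    usedHeight d (i :: L) t l = usedHeight d L (t - edgeHeight d i) l := by
  simp [usedHeight, accum, Pi.single_eq_of_ne' h]

theorem accum_eq_sum (c : Fin n → ℝ) (L : List (Fin n)) (t : ℝ) :
    accum d c L t = ∑ l, c l * usedHeight d L t l := by
  induction L generalizing t with
  | nil => simp [accum, usedHeight]
  | cons i L ih =>
    simp only [usedHeight, accum] at ih ⊢
    simp only [ih, mul_add, Finset.sum_add_distrib, Pi.single_apply, ite_mul,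
      one_mul, zero_mul, mul_ite, mul_zero, Finset.sum_ite_eq, Finset.mem_univ, if_true]

theorem usedHeight_of_notMem {L : List (Fin n)} {l : Fin n} (h : l ∉ L) (t : ℝ) :
    usedHeight d L t l = 0 := by
  induction L generalizing t with
  | nil => rfl
  | cons i L ih =>
    rw [List.mem_cons, not_or] at h
    rw [usedHeight_cons_of_ne h.1, ih h.2]

theorem usedHeight_nonneg (L : List (Fin n)) (t : ℝ) (l : Fin n) : 0 ≤ usedHeight d L t l := by
  induction L generalizing t with
  | nil => exact le_rfl
  | cons i L ih =>
    rcases eq_or_ne l i with rfl | h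
    · rw [usedHeight_cons_self]
      exact add_nonneg (le_max_left _ _) (ih _)
    · rw [usedHeight_cons_of_ne h]
      exact ih _

namespace IsEdgeSystem

variable (hd : IsEdgeSystem d)
include hd

theorem edgeHeight_pos (i : Fin n) : 0 < edgeHeight d i :=
  neg_pos.2 (hd.1 i)

theorem edgeSlope_mul (i : Fin n) : edgeSlope d i * edgeHeight d i = (d i).1 :=
  div_mul_cancel₀ _ (hd.edgeHeight_pos i).ne'

theorem strictMono_edgeSlope : StrictMono (edgeSlope d) := by
  intro i j hij
  have := hd.2 i j hij
  rw [edgeSlope, edgeSlope, div_lt_div_iff₀ (hd.edgeHeight_pos i) (hd.edgeHeight_pos j),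
    edgeHeight, edgeHeight]
  linarith

theorem wordHeight_nonneg (L : List (Fin n)) : 0 ≤ wordHeight d L :=
  List.sum_nonneg <| by simpa using fun i _ => (hd.edgeHeight_pos i).le

theorem wordHeight_pos {L : List (Fin n)} (hL : L ≠ []) : 0 < wordHeight d L := by
  obtain ⟨i, L, rfl⟩ := List.exists_cons_of_ne_nil hL
  rw [wordHeight_cons]
  linarith [hd.edgeHeight_pos i, hd.wordHeight_nonneg L]

theorem add_snd_lt (a : ℝ × ℝ) (i : Fin n) : (a + d i).2 < a.2 := by simpa using hd.1 i

theorem add_wordSum_snd_le (a : ℝ × ℝ) (L : List (Fin n)) : (a + wordSum d L).2 ≤ a.2 := by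
  rw [add_wordSum_snd]
  exact sub_le_self _ (hd.wordHeight_nonneg L)

theorem add_wordSum_snd_lt (a : ℝ × ℝ) {L : List (Fin n)} (hL : L ≠ []) :
    (a + wordSum d L).2 < a.2 := by
  rw [add_wordSum_snd]
  exact sub_lt_self _ (hd.wordHeight_pos hL)

theorem accum_of_nonpos (c : Fin n → ℝ) (L : List (Fin n)) {t : ℝ} (ht : t ≤ 0) :
    accum d c L t = 0 := by
  induction L generalizing t with
  | nil => rfl
  | cons i L ih =>
    have := hd.edgeHeight_pos i
    rw [accum, ih (by linarith), min_eq_left (by linarith), max_eq_left ht, mul_zero, add_zero]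

theorem accum_of_wordHeight_le (c : Fin n → ℝ) (L : List (Fin n)) {t : ℝ}
    (ht : wordHeight d L ≤ t) : accum d c L t = (L.map fun i => c i * edgeHeight d i).sum := by
  induction L generalizing t with
  | nil => rfl
  | cons i L ih =>
    have := hd.edgeHeight_pos i
    have := hd.wordHeight_nonneg L
    rw [wordHeight_cons] at ht
    rw [accum, ih (by linarith), min_eq_right (by linarith), max_eq_right (by linarith),
      List.map_cons, List.sum_cons]

theorem accum_one (L : List (Fin n)) (t : ℝ) :
    accum d 1 L t = max 0 (min t (wordHeight d L)) := by
  induction L generalizing t with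
  | nil => simp [accum, wordHeight]
  | cons i L ih =>
    have := hd.edgeHeight_pos i
    have := hd.wordHeight_nonneg L
    simp only [accum, ih, wordHeight_cons, Pi.one_apply, one_mul, max_def, min_def]
    split_ifs <;> linarith

theorem sum_usedHeight (L : List (Fin n)) (t : ℝ) :
    ∑ l, usedHeight d L t l = max 0 (min t (wordHeight d L)) := by
  simpa [hd.accum_one] using (accum_eq_sum (d := d) 1 L t).symm

theorem usedHeight_le {L : List (Fin n)} (hL : L.Nodup) (t : ℝ) (l : Fin n) :
    usedHeight d L t l ≤ edgeHeight d l := by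
  induction L generalizing t with
  | nil => exact (hd.edgeHeight_pos l).le
  | cons i L ih =>
    rw [List.nodup_cons] at hL
    rcases eq_or_ne l i with rfl | h
    · rw [usedHeight_cons_self, usedHeight_of_notMem hL.1, add_zero]
      exact max_le (hd.edgeHeight_pos l).le (min_le_right _ _)
    · rw [usedHeight_cons_of_ne h]
      exact ih hL.2 _

theorem usedHeight_of_pair_sublist {L : List (Fin n)} (hL : L.Nodup) {a b : Fin n}
    (hab : [a, b].Sublist L) {t : ℝ} (hb : 0 < usedHeight d L t b) :
    usedHeight d L t a = edgeHeight d a := by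
  have hne : a ≠ b := pair_sublist_ne hL hab
  induction L generalizing t with
  | nil => simp at hab
  | cons i L ih =>
    rw [List.nodup_cons] at hL
    rcases pair_sublist_cons.1 hab with ⟨rfl, -⟩ | hsub
    · rw [usedHeight_cons_of_ne hne.symm] at hb
      have ht : 0 < t - edgeHeight d a :=
        not_le.1 fun hle => hb.ne' (hd.accum_of_nonpos _ _ hle)
      rw [usedHeight_cons_self, usedHeight_of_notMem hL.1, min_eq_right (by linarith),
        max_eq_right (hd.edgeHeight_pos a).le, add_zero]
    · obtain ⟨ha, hbL⟩ := mem_of_pair_sublist hsub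
      rw [usedHeight_cons_of_ne (ne_of_mem_of_not_mem hbL hL.1)] at hb
      rw [usedHeight_cons_of_ne (ne_of_mem_of_not_mem ha hL.1)]
      exact ih hL.2 hsub hb

theorem usedHeight_of_wordHeight_le {L : List (Fin n)} (hL : L.Nodup) {l : Fin n} (hl : l ∈ L)
    {t : ℝ} (ht : wordHeight d L ≤ t) : usedHeight d L t l = edgeHeight d l := by
  obtain ⟨α, β, rfl⟩ := List.append_of_mem hl
  simp only [List.nodup_append, List.nodup_cons, List.mem_cons, forall_eq_or_imp] at hL
  obtain ⟨-, ⟨hβ, -⟩, hα⟩ := hL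
  have hzero (M : List (Fin n)) (hM : l ∉ M) :
      (M.map fun i => (Pi.single l 1 : Fin n → ℝ) i * edgeHeight d i).sum = 0 := by
    rw [← hd.accum_of_wordHeight_le _ _ le_rfl]
    exact usedHeight_of_notMem hM _
  rw [usedHeight, hd.accum_of_wordHeight_le _ _ ht, List.map_append, List.map_cons,
    List.sum_append, List.sum_cons, hzero _ fun hmem => (hα l hmem).1 rfl, hzero _ hβ,
    Pi.single_eq_same]
  ring

theorem usedHeight_vertex {α β : List (Fin n)} (h : (α ++ β).Nodup) (l : Fin n) :
    usedHeight d (α ++ β) (wordHeight d α) l = 0 ∨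
      usedHeight d (α ++ β) (wordHeight d α) l = edgeHeight d l := by
  rw [usedHeight, accum_append, hd.accum_of_nonpos _ β (sub_self _).le, add_zero, ← usedHeight]
  by_cases hl : l ∈ α
  · exact Or.inr (hd.usedHeight_of_wordHeight_le (List.nodup_append.1 h).1 hl le_rfl)
  · exact Or.inl (usedHeight_of_notMem hl _)

theorem usedHeight_edge {α β : List (Fin n)} {i : Fin n} (h : (α ++ i :: β).Nodup) {r : ℝ}
    (h0 : 0 ≤ r) (h1 : r ≤ edgeHeight d i) :
    usedHeight d (α ++ i :: β) (wordHeight d α + r) i = r := by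
  have hi : i ∉ α := fun hi => (List.nodup_append.1 h).2.2 i hi i List.mem_cons_self rfl
  rw [usedHeight, accum_append, ← usedHeight, usedHeight_of_notMem hi, add_sub_cancel_left, accum,
    hd.accum_of_nonpos _ β (by linarith), min_eq_left h1, max_eq_right h0, Pi.single_eq_same]
  ring

theorem pathX_of_top_le {a : ℝ × ℝ} (L : List (Fin n)) {y : ℝ} (hy : a.2 ≤ y) :
    pathX d a L y = a.1 := by
  rw [pathX, hd.accum_of_nonpos _ L (by linarith), add_zero]

theorem pathX_of_le_bottom {a : ℝ × ℝ} {L : List (Fin n)} {y : ℝ}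
    (hy : y ≤ (a + wordSum d L).2) : pathX d a L y = (a + wordSum d L).1 := by
  rw [add_wordSum_snd] at hy
  rw [pathX, hd.accum_of_wordHeight_le _ L (by linarith), Prod.fst_add, wordSum]
  simp only [hd.edgeSlope_mul]
  have hfst := (map_list_sum (AddMonoidHom.fst ℝ ℝ) (L.map d)).symm
  exact congrArg (a.1 + ·) (by simpa [Function.comp_def] using hfst)

theorem pathX_append_of_ge (a : ℝ × ℝ) (α β : List (Fin n)) {y : ℝ}
    (hy : (a + wordSum d α).2 ≤ y) : pathX d a (α ++ β) y = pathX d a α y := by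
  rw [add_wordSum_snd] at hy
  rw [pathX, accum_append, hd.accum_of_nonpos _ β (by linarith), add_zero, pathX]

theorem pathX_append_of_le (a : ℝ × ℝ) (α β : List (Fin n)) {y : ℝ}
    (hy : y ≤ (a + wordSum d α).2) :
    pathX d a (α ++ β) y = pathX d (a + wordSum d α) β y := by
  rw [pathX, accum_append, ← add_assoc, ← pathX, hd.pathX_of_le_bottom hy, pathX, add_wordSum_snd,
    sub_right_comm]

theorem pathX_vertex (a : ℝ × ℝ) (α β : List (Fin n)) :
    pathX d a (α ++ β) (a + wordSum d α).2 = (a + wordSum d α).1 := by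
  rw [hd.pathX_append_of_le _ _ _ le_rfl, hd.pathX_of_top_le _ le_rfl]

theorem pathX_cons (a : ℝ × ℝ) (i : Fin n) (L : List (Fin n)) {r : ℝ} (h0 : 0 ≤ r)
    (h1 : r ≤ edgeHeight d i) : pathX d a (i :: L) (a.2 - r) = a.1 + edgeSlope d i * r := by
  rw [pathX, accum, sub_sub_cancel, hd.accum_of_nonpos _ L (by linarith), min_eq_left h1,
    max_eq_right h0, add_zero]

theorem pathX_cons_of_le (a : ℝ × ℝ) (i : Fin n)
    (L : List (Fin n)) {y : ℝ} (hy : y ≤ (a + d i).2) :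
    pathX d a (i :: L) y = pathX d (a + d i) L y := by
  simpa [wordSum] using hd.pathX_append_of_le a [i] L (y := y) (by simpa [wordSum] using hy)

theorem pathX_edge (a : ℝ × ℝ) (α : List (Fin n)) (i : Fin n) (β : List (Fin n)) {r : ℝ}
    (h0 : 0 ≤ r) (h1 : r ≤ edgeHeight d i) :
    pathX d a (α ++ i :: β) ((a + wordSum d α).2 - r) =
      (a + wordSum d α).1 + edgeSlope d i * r := by
  rw [hd.pathX_append_of_le _ _ _ (by linarith), hd.pathX_cons _ _ _ h0 h1]

theorem add_smul_edge (v : ℝ × ℝ) (i : Fin n) (θ : ℝ) : v + θ • (v + d i - v) =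
    (v.1 + edgeSlope d i * (θ * edgeHeight d i), v.2 - θ * edgeHeight d i) := by
  ext
  · simp [← hd.edgeSlope_mul, mul_left_comm]
  · simp [edgeHeight]

theorem mem_edge_iff {v q : ℝ × ℝ} {i : Fin n} :
    q ∈ segment ℝ v (v + d i) ↔
      ∃ r, 0 ≤ r ∧ r ≤ edgeHeight d i ∧ q = (v.1 + edgeSlope d i * r, v.2 - r) := by
  have hpos := hd.edgeHeight_pos i
  simp only [segment_eq_image', Set.mem_image, Set.mem_Icc, hd.add_smul_edge]
  constructor
  · rintro ⟨θ, ⟨h0, h1⟩, rfl⟩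
    exact ⟨θ * edgeHeight d i, by positivity, mul_le_of_le_one_left hpos.le h1, rfl⟩
  · rintro ⟨r, h0, h1, rfl⟩
    exact ⟨r / edgeHeight d i, ⟨by positivity, (div_le_one hpos).2 h1⟩,
      by rw [div_mul_cancel₀ _ hpos.ne']⟩

theorem mem_openEdge_iff {v q : ℝ × ℝ} {i : Fin n} :
    q ∈ openSegment ℝ v (v + d i) ↔
      ∃ r, 0 < r ∧ r < edgeHeight d i ∧ q = (v.1 + edgeSlope d i * r, v.2 - r) := by
  have hpos := hd.edgeHeight_pos i
  simp only [openSegment_eq_image', Set.mem_image, Set.mem_Ioo, hd.add_smul_edge]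
  constructor
  · rintro ⟨θ, ⟨h0, h1⟩, rfl⟩
    exact ⟨θ * edgeHeight d i, by positivity, mul_lt_of_lt_one_left hpos h1, rfl⟩
  · rintro ⟨r, h0, h1, rfl⟩
    exact ⟨r / edgeHeight d i, ⟨by positivity, (div_lt_one hpos).2 h1⟩,
      by rw [div_mul_cancel₀ _ hpos.ne']⟩

theorem pathX_append_append (a : ℝ × ℝ) (α L β : List (Fin n)) {y : ℝ}
    (hy : y ∈ Set.Icc (a + wordSum d α + wordSum d L).2 (a + wordSum d α).2) :
    pathX d a (α ++ L ++ β) y = pathX d (a + wordSum d α) L y := by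
  rw [List.append_assoc, hd.pathX_append_of_le _ _ _ hy.2, hd.pathX_append_of_ge _ _ _ hy.1]

theorem pathX_eq_of_perm_of_notMem {a : ℝ × ℝ} {L M : List (Fin n)} (h : L.Perm M) {y : ℝ}
    (hy : y ∉ Set.Ioo (a + wordSum d M).2 a.2) : pathX d a L y = pathX d a M y := by
  rcases le_or_gt a.2 y with htop | htop
  · rw [hd.pathX_of_top_le L htop, hd.pathX_of_top_le M htop]
  · have hbot : y ≤ (a + wordSum d M).2 := not_lt.1 fun hlt => hy ⟨hlt, htop⟩
    rw [hd.pathX_of_le_bottom hbot, hd.pathX_of_le_bottom (by rwa [wordSum_perm h]), wordSum_perm h]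

theorem mem_pathPoints {a : ℝ × ℝ} {L : List (Fin n)} {q : ℝ × ℝ} :
    q ∈ pathPoints d a L ↔ q.2 ∈ Set.Icc (a + wordSum d L).2 a.2 ∧ q.1 = pathX d a L q.2 := by
  induction L generalizing a with
  | nil =>
    simp only [pathPoints, wordSum, List.map_nil, List.sum_nil, add_zero, Set.Icc_self, pathX,
      accum, Set.mem_singleton_iff, Prod.ext_iff, and_comm]
  | cons i L ih =>
    have hpos := hd.edgeHeight_pos i
    have hL := hd.wordHeight_nonneg L
    have hsnd : (a + d i).2 = a.2 - edgeHeight d i := by simp [edgeHeight]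
    simp only [pathPoints, Set.mem_union, ih, hd.mem_edge_iff, add_wordSum_snd, wordHeight_cons,
      Set.mem_Icc]
    constructor
    · rintro (⟨r, h0, h1, rfl⟩ | ⟨⟨h0, h1⟩, hx⟩)
      · exact ⟨⟨by dsimp only; linarith, by dsimp only; linarith⟩, (hd.pathX_cons a i L h0 h1).symm⟩
      · exact ⟨⟨by linarith, by linarith⟩, by rw [hx, hd.pathX_cons_of_le a i L h1]⟩
    · rintro ⟨⟨h0, h1⟩, hx⟩
      rcases le_total q.2 (a + d i).2 with h | h
      · exact Or.inr ⟨⟨by linarith, h⟩, by rw [hx, hd.pathX_cons_of_le a i L h]⟩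
      · have hcons := hd.pathX_cons a i L (r := a.2 - q.2) (by linarith) (by linarith)
        rw [sub_sub_cancel] at hcons
        exact Or.inl ⟨a.2 - q.2, by linarith, by linarith,
          Prod.ext (by rw [hx, hcons]) (by rw [sub_sub_cancel])⟩

end IsEdgeSystem

theorem pathX_append_append_congr (a : ℝ × ℝ) (α β : List (Fin n)) {L M : List (Fin n)}
    {y : ℝ} (hperm : L.Perm M)
    (h : pathX d (a + wordSum d α) L y = pathX d (a + wordSum d α) M y) :
    pathX d a (α ++ L ++ β) y = pathX d a (α ++ M ++ β) y := by
  simp only [pathX, accum_append, wordHeight_append, wordHeight_perm hperm, add_wordSum_snd,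
    sub_right_comm _ (wordHeight d α), add_right_inj] at h ⊢
  rw [h]

theorem mem_pathVertices {a : ℝ × ℝ} {L : List (Fin n)} {q : ℝ × ℝ} :
    q ∈ pathVertices d a L ↔ ∃ α β, L = α ++ β ∧ q = a + wordSum d α := by
  induction L generalizing a with
  | nil => simp [pathVertices, wordSum]
  | cons i L ih =>
    simp only [pathVertices, List.mem_cons, ih, List.cons_eq_append_iff]
    constructor
    · rintro (rfl | ⟨α, β, rfl, rfl⟩)
      · exact ⟨[], i :: L, by simp, by simp [wordSum]⟩
      · exact ⟨i :: α, β, by simp, by simp [wordSum, add_assoc]⟩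
    · rintro ⟨α, β, (⟨rfl, rfl⟩ | ⟨α, rfl, rfl⟩), rfl⟩
      · simp [wordSum]
      · exact Or.inr ⟨α, β, rfl, by simp [wordSum, add_assoc]⟩

theorem mem_pathEdges {a : ℝ × ℝ} {L : List (Fin n)} {e : (ℝ × ℝ) × Fin n} :
    e ∈ pathEdges d a L ↔ ∃ α β, L = α ++ e.2 :: β ∧ e.1 = a + wordSum d α := by
  induction L generalizing a with
  | nil => simp [pathEdges]
  | cons i L ih =>
    simp only [pathEdges, List.mem_cons, ih, List.cons_eq_append_iff]
    constructor
    · rintro (rfl | ⟨α, β, rfl, he⟩)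
      · exact ⟨[], L, by simp, by simp [wordSum]⟩
      · exact ⟨i :: α, β, by simp, by simp [he, wordSum, add_assoc]⟩
    · rintro ⟨α, β, (⟨rfl, h⟩ | ⟨α, rfl, rfl⟩), he⟩
      · simp only [List.cons.injEq] at h
        exact Or.inl (Prod.ext (by simpa [wordSum] using he) h.1)
      · exact Or.inr ⟨α, β, rfl, by simp [he, wordSum, add_assoc]⟩

end Path

section Compare

theorem sum_mul_nonneg_of_strictMono {ι : Type*} [Fintype ι] [LinearOrder ι] {s μ : ι → ℝ}
    (hs : StrictMono s) (h0 : ∑ l, μ l = 0) (h : ∀ i j, 0 < μ i → μ j < 0 → j < i) :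
    0 ≤ ∑ l, s l * μ l ∧ (∑ l, s l * μ l = 0 → μ = 0) := by
  by_cases hpos : ∃ i, 0 < μ i
  · obtain ⟨i, hi, hmin⟩ := WellFounded.has_min (wellFounded_lt (α := ι)) {i | 0 < μ i} hpos
    have hshift : ∑ l, s l * μ l = ∑ l, (s l - s i) * μ l := by
      simp only [sub_mul, Finset.sum_sub_distrib, ← Finset.mul_sum, h0, mul_zero, sub_zero]
    have hneg {l : ι} (hl : μ l < 0) : 0 < (s l - s i) * μ l :=
      mul_pos_of_neg_of_neg (sub_neg.2 (hs (h i l hi hl))) hl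
    have hterm (l : ι) : 0 ≤ (s l - s i) * μ l := by
      rcases lt_trichotomy (μ l) 0 with hl | hl | hl
      · exact (hneg hl).le
      · simp [hl]
      · exact mul_nonneg (sub_nonneg.2 (hs.monotone (not_lt.1 (hmin l hl)))) hl.le
    rw [hshift]
    refine ⟨Finset.sum_nonneg fun l _ => hterm l, fun hz => ?_⟩
    rw [Finset.sum_eq_zero_iff_of_nonneg fun l _ => hterm l] at hz
    have hnonneg (l : ι) : 0 ≤ μ l := not_lt.1 fun hl => (hneg hl).ne' (hz l (Finset.mem_univ l))
    exact funext fun l =>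
      (Finset.sum_eq_zero_iff_of_nonneg fun l _ => hnonneg l).1 h0 l (Finset.mem_univ l)
  · push Not at hpos
    have hz : μ = 0 := funext fun l =>
      (Finset.sum_eq_zero_iff_of_nonpos fun l _ => hpos l).1 h0 l (Finset.mem_univ l)
    simp [hz]

variable {n : ℕ} {d : Fin n → ℝ × ℝ} {L L' : List (Fin n)}

theorem WeakLE.lt_of_usedHeight_lt (hd : IsEdgeSystem d) (h : WeakLE L L') (hL' : L'.Nodup)
    (hp : L.Perm L') {t : ℝ} {i j : Fin n} (hi : usedHeight d L t i < usedHeight d L' t i)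
    (hj : usedHeight d L' t j < usedHeight d L t j) : j < i := by
  have hL : L.Nodup := hp.nodup_iff.2 hL'
  have hne : i ≠ j := by rintro rfl; exact lt_asymm hi hj
  have hiL : i ∈ L := by
    by_contra hc
    simp [usedHeight_of_notMem hc, usedHeight_of_notMem (mt hp.mem_iff.2 hc)] at hi
  have hjL : j ∈ L := by
    by_contra hc
    simp [usedHeight_of_notMem hc, usedHeight_of_notMem (mt hp.mem_iff.2 hc)] at hj
  have hji : [j, i].Sublist L := (pair_sublist_total hne hiL hjL).resolve_left fun hs =>
    absurd (hd.usedHeight_of_pair_sublist hL hs ((usedHeight_nonneg L' t j).trans_lt hj))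
      (hi.trans_le (hd.usedHeight_le hL' t i)).ne
  refine hne.lt_or_gt.resolve_left fun hij => ?_
  exact absurd (hd.usedHeight_of_pair_sublist hL' (h i j hij hji)
    ((usedHeight_nonneg L t i).trans_lt hi)) (hj.trans_le (hd.usedHeight_le hL t j)).ne

theorem WeakLE.accum_edgeSlope_le (hd : IsEdgeSystem d) (h : WeakLE L L') (hL' : L'.Nodup)
    (hp : L.Perm L') (t : ℝ) :
    accum d (edgeSlope d) L t ≤ accum d (edgeSlope d) L' t ∧
      (accum d (edgeSlope d) L t = accum d (edgeSlope d) L' t →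
        usedHeight d L t = usedHeight d L' t) := by
  have hsum := sum_mul_nonneg_of_strictMono hd.strictMono_edgeSlope
    (μ := usedHeight d L' t - usedHeight d L t)
    (by simp [hd.sum_usedHeight, wordHeight_perm hp])
    (fun i j hi hj => h.lt_of_usedHeight_lt hd hL' hp (sub_pos.1 hi) (sub_neg.1 hj))
  simp only [Pi.sub_apply, mul_sub, Finset.sum_sub_distrib, ← accum_eq_sum, sub_nonneg,
    sub_eq_zero] at hsum
  exact ⟨hsum.1, fun heq => (hsum.2 heq.symm).symm⟩

theorem WeakLE.pathX_le (hd : IsEdgeSystem d) (h : WeakLE L L') (hL' : L'.Nodup)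
    (hp : L.Perm L') (a : ℝ × ℝ) (y : ℝ) : pathX d a L y ≤ pathX d a L' y :=
  add_le_add_right (h.accum_edgeSlope_le hd hL' hp _).1 _

theorem WeakLE.notMem_openSegment (hd : IsEdgeSystem d) (h : WeakLE L L' ∨ WeakLE L' L)
    (hL' : L'.Nodup) (hp : L.Perm L') {a q : ℝ × ℝ} {e : (ℝ × ℝ) × Fin n}
    (hq : q ∈ pathVertices d a L) (he : e ∈ pathEdges d a L') :
    q ∉ openSegment ℝ e.1 (e.1 + d e.2) := by
  intro hqe
  have hL : L.Nodup := hp.nodup_iff.2 hL'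
  obtain ⟨α, β, rfl, rfl⟩ := mem_pathVertices.1 hq
  obtain ⟨α', β', rfl, htop⟩ := mem_pathEdges.1 he
  obtain ⟨r, h0, h1, hqr⟩ := hd.mem_openEdge_iff.1 hqe
  rw [htop] at hqr
  have hx : pathX d a (α ++ β) (a + wordSum d α).2 =
      pathX d a (α' ++ e.2 :: β') (a + wordSum d α).2 := by
    rw [hd.pathX_vertex, congrArg Prod.snd hqr, hd.pathX_edge a α' e.2 β' h0.le h1.le,
      congrArg Prod.fst hqr]
  have hy := congrArg Prod.snd hqr
  simp only [add_wordSum_snd] at hy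
  rw [pathX, pathX, add_wordSum_snd, sub_sub_cancel, add_right_inj] at hx
  have hused : usedHeight d (α ++ β) (wordHeight d α) =
      usedHeight d (α' ++ e.2 :: β') (wordHeight d α) := by
    rcases h with h | h
    · exact (h.accum_edgeSlope_le hd hL' hp _).2 hx
    · exact ((h.accum_edgeSlope_le hd hL hp.symm _).2 hx.symm).symm
  have hedge : usedHeight d (α' ++ e.2 :: β') (wordHeight d α) e.2 = r := by
    rw [← hd.usedHeight_edge hL' h0.le h1.le]
    congr 1
    linarith
  rw [← hused] at hedge
  rcases hd.usedHeight_vertex hL e.2 with hv | hv <;> linarith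

end Compare

/-! ### Horizontal slices of Elnitsky polygons -/

namespace ElnitskyPolygon

variable {n : ℕ} (d : Fin n → ℝ × ℝ) (P : ElnitskyPolygon n)

/-- The lowest vertex. -/
def bottom : ℝ × ℝ := P.top + wordSum d P.word

/-- The abscissa of the left border at a given height. -/
noncomputable def leftX (y : ℝ) : ℝ := pathX d P.top P.leftWord y

/-- The abscissa of the right border at a given height. -/
noncomputable def rightX (y : ℝ) : ℝ := pathX d P.top P.word y

/-- The abscissa halfway between the two borders at a given height. -/
noncomputable def midX (y : ℝ) : ℝ := (P.leftX d y + P.rightX d y) / 2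

/-- The horizontal slice of the interior at a given height. -/
def slice (y : ℝ) : Set ℝ := Set.Ioo (P.leftX d y) (P.rightX d y)

theorem leftWord_perm : P.leftWord.Perm P.word :=
  (Finset.sort_perm_toList _ _).trans (List.toFinset_toList P.nodup)

theorem leftWord_weakLE (L : List (Fin n)) : WeakLE P.leftWord L :=
  WeakLE.of_sorted (Finset.pairwise_sort _ _)

theorem append_leftWord_append_perm (α β : List (Fin n)) :
    (α ++ P.leftWord ++ β).Perm (α ++ P.word ++ β) :=
  (P.leftWord_perm.append_left α).append_right β

theorem append_leftWord_append_weakLE (α β : List (Fin n)) :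
    WeakLE (α ++ P.leftWord ++ β) (α ++ P.word ++ β) :=
  (P.leftWord_weakLE _).append_append P.leftWord_perm α β

variable {d P}

theorem continuous_leftX : Continuous (P.leftX d) := continuous_pathX _ _

theorem continuous_rightX : Continuous (P.rightX d) := continuous_pathX _ _

theorem continuous_midX : Continuous (P.midX d) :=
  (continuous_leftX.add continuous_rightX).div_const 2

theorem leftX_le_rightX (hd : IsEdgeSystem d) (y : ℝ) : P.leftX d y ≤ P.rightX d y :=
  (P.leftWord_weakLE _).pathX_le hd P.nodup P.leftWord_perm _ _

theorem mem_Ioo_of_leftX_lt_rightX (hd : IsEdgeSystem d) {y : ℝ}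
    (h : P.leftX d y < P.rightX d y) : y ∈ Set.Ioo (P.bottom d).2 P.top.2 :=
  by_contra fun hy => h.ne (hd.pathX_eq_of_perm_of_notMem P.leftWord_perm hy)

theorem mem_region (hd : IsEdgeSystem d) {q : ℝ × ℝ} :
    q ∈ P.region d ↔ q.2 ∈ Set.Icc (P.bottom d).2 P.top.2 ∧
      q.1 ∈ Set.Icc (P.leftX d q.2) (P.rightX d q.2) := by
  simp only [region, leftBorder, rightBorder, Set.mem_ofPred_eq, hd.mem_pathPoints,
    wordSum_perm P.leftWord_perm]
  constructor
  · rintro ⟨_, _, hl, hr, ⟨hy, rfl⟩, -, rfl⟩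
    exact ⟨hy, hl, hr⟩
  · rintro ⟨hy, hl, hr⟩
    exact ⟨_, _, hl, hr, ⟨hy, rfl⟩, hy, rfl⟩

theorem mem_region_of_leftX_lt (hd : IsEdgeSystem d) {x y : ℝ} (hlt : P.leftX d y < P.rightX d y)
    (hx : x ∈ Set.Icc (P.leftX d y) (P.rightX d y)) : (x, y) ∈ P.region d :=
  (mem_region hd).2 ⟨Set.Ioo_subset_Icc_self (mem_Ioo_of_leftX_lt_rightX hd hlt), hx⟩

theorem rightX_mem_region (hd : IsEdgeSystem d) {y : ℝ}
    (hy : y ∈ Set.Icc (P.bottom d).2 P.top.2) : (P.rightX d y, y) ∈ P.region d :=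
  (mem_region hd).2 ⟨hy, P.leftX_le_rightX hd y, le_rfl⟩

theorem mem_interior_region (hd : IsEdgeSystem d) {q : ℝ × ℝ} :
    q ∈ interior (P.region d) ↔ q.1 ∈ P.slice d q.2 := by
  have hl := continuous_leftX (d := d) (P := P)
  have hr := continuous_rightX (d := d) (P := P)
  constructor
  · intro h
    have hcont : Continuous fun x : ℝ => (x, q.2) := by fun_prop
    have hsub : (fun x : ℝ => (x, q.2)) ⁻¹' interior (P.region d) ⊆
        Set.Icc (P.leftX d q.2) (P.rightX d q.2) :=
      fun x hx => ((mem_region hd).1 (interior_subset hx)).2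
    rw [slice, ← interior_Icc]
    exact interior_maximal hsub (isOpen_interior.preimage hcont) h
  · intro h
    refine interior_maximal (s := P.region d) (t := {q | q.1 ∈ P.slice d q.2}) ?_ ?_ h
    · exact fun q hq =>
        mem_region_of_leftX_lt hd (hq.1.trans hq.2) (Set.Ioo_subset_Icc_self hq)
    · exact (isOpen_lt (hl.comp continuous_snd) continuous_fst).inter
        (isOpen_lt continuous_fst (hr.comp continuous_snd))

theorem disjoint_slice (hd : IsEdgeSystem d) {Q : ElnitskyPolygon n}
    (h : Disjoint (P.region d) (interior (Q.region d))) (y : ℝ) :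
    Disjoint (P.slice d y) (Q.slice d y) :=
  Set.disjoint_left.2 fun x hP hQ => Set.disjoint_left.1 h
    (interior_subset ((mem_interior_region hd (q := (x, y))).2 hP))
    ((mem_interior_region hd (q := (x, y))).2 hQ)

theorem pathX_append_leftWord_append (hd : IsEdgeSystem d) {a : ℝ × ℝ} {α : List (Fin n)}
    (htop : P.top = a + wordSum d α) (β : List (Fin n)) (y : ℝ) :
    (P.leftX d y < P.rightX d y ∧ pathX d a (α ++ P.leftWord ++ β) y = P.leftX d y ∧
        pathX d a (α ++ P.word ++ β) y = P.rightX d y) ∨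
      (pathX d a (α ++ P.leftWord ++ β) y = pathX d a (α ++ P.word ++ β) y ∧
        P.leftX d y = P.rightX d y) := by
  have hle := P.leftX_le_rightX hd y
  rw [leftX, rightX, htop] at *
  by_cases heq : pathX d (a + wordSum d α) P.leftWord y = pathX d (a + wordSum d α) P.word y
  · exact Or.inr ⟨pathX_append_append_congr a α β P.leftWord_perm heq, heq⟩
  · have hy := Set.Ioo_subset_Icc_self <|
      not_imp_comm.1 (hd.pathX_eq_of_perm_of_notMem P.leftWord_perm) heq
    have hy' := hy
    rw [← wordSum_perm P.leftWord_perm] at hy'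
    exact Or.inl ⟨hle.lt_of_ne heq, hd.pathX_append_append a α _ β hy',
      hd.pathX_append_append a α _ β hy⟩

theorem hasShape_iff_exists_ofFn {k : ℕ} {p : Equiv.Perm (Fin k)} :
    P.HasShape p ↔ ∃ f : Fin k → Fin n, P.word = List.ofFn f ∧ ∀ a b, p a < p b ↔ f a < f b := by
  constructor
  · rintro ⟨rfl, hf⟩
    exact ⟨P.word.get, (List.ofFn_get _).symm, hf⟩
  · rintro ⟨f, hword, hf⟩
    refine ⟨by simp [hword], fun a b => ?_⟩
    simp [hf, hword]

theorem labels_eq_image {k : ℕ} {f : Fin k → Fin n} (hword : P.word = List.ofFn f) :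
    P.labels = Finset.univ.image f := by
  ext i
  simp [labels, hword, List.mem_ofFn]

theorem isRhombus_iff : P.IsRhombus ↔ ∃ i j : Fin n, i < j ∧ P.word = [j, i] := by
  rw [IsRhombus, hasShape_iff_exists_ofFn]
  constructor
  · rintro ⟨f, hword, hf⟩
    exact ⟨f 1, f 0, (hf 1 0).1 (by decide), by simpa using hword⟩
  · rintro ⟨i, j, hij, hword⟩
    refine ⟨![j, i], by simpa using hword, fun a b => ?_⟩
    fin_cases a <;> fin_cases b <;> simp [hij, hij.le]

theorem leftWord_of_word_eq_pair {i j : Fin n} (hij : i < j) (hword : P.word = [j, i]) :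
    P.leftWord = [i, j] := by
  have hperm : P.leftWord.Perm [i, j] := P.leftWord_perm.trans (hword ▸ List.Perm.swap _ _ _)
  exact hperm.eq_of_pairwise' (Finset.pairwise_sort _ _) (by simp [hij.le])

end ElnitskyPolygon

/-! ### Sweeping from one path to another by polygons -/

section Sweep

variable {n : ℕ} {d : Fin n → ℝ × ℝ}

/-- `Sweep d a L Ts L'`: the path of the word `L` with top `a` is moved to that of `L'` by
replacing successively the left border of each polygon in `Ts` by its right border. -/
inductive Sweep (d : Fin n → ℝ × ℝ) (a : ℝ × ℝ) :
    List (Fin n) → List (ElnitskyPolygon n) → List (Fin n) → Prop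
  | nil (L : List (Fin n)) : Sweep d a L [] L
  | cons (P : ElnitskyPolygon n) (α β : List (Fin n)) (htop : P.top = a + wordSum d α)
      {Ts : List (ElnitskyPolygon n)} {L' : List (Fin n)}
      (h : Sweep d a (α ++ P.word ++ β) Ts L') :
      Sweep d a (α ++ P.leftWord ++ β) (P :: Ts) L'

namespace Sweep

variable {a : ℝ × ℝ} {L M N : List (Fin n)} {Ts Us : List (ElnitskyPolygon n)}

theorem trans (h : Sweep d a L Ts M) (h' : Sweep d a M Us N) : Sweep d a L (Ts ++ Us) N := by
  induction h with
  | nil => exact h'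
  | cons P α β htop _ ih => exact .cons P α β htop (ih h')

theorem perm (h : Sweep d a L Ts M) : L.Perm M := by
  induction h with
  | nil => exact .refl _
  | cons P α β _ _ ih => exact (P.append_leftWord_append_perm α β).trans ih

theorem weakLE (h : Sweep d a L Ts M) : WeakLE L M := by
  induction h with
  | nil => exact WeakLE.refl _
  | cons P α β _ _ ih => exact (P.append_leftWord_append_weakLE α β).trans ih

theorem mem_Icc_of_mem_region (hd : IsEdgeSystem d) (h : Sweep d a L Ts M) (hM : M.Nodup)
    {P : ElnitskyPolygon n} (hP : P ∈ Ts) {q : ℝ × ℝ} (hq : q ∈ P.region d) :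
    q.2 ∈ Set.Icc (a + wordSum d M).2 a.2 ∧ q.1 ∈ Set.Icc (pathX d a L q.2) (pathX d a M q.2) := by
  induction h with
  | nil => simp at hP
  | @cons R α β htop Ts M hsweep ih =>
    have hnd : (α ++ R.word ++ β).Nodup := hsweep.perm.nodup_iff.2 hM
    rcases List.mem_cons.1 hP with rfl | hP
    · obtain ⟨hy, hx⟩ := (ElnitskyPolygon.mem_region hd).1 hq
      rw [ElnitskyPolygon.bottom, htop] at hy
      have hleft := hd.pathX_append_append a α P.leftWord β
        (by rwa [wordSum_perm P.leftWord_perm])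
      have hright := hd.pathX_append_append a α P.word β hy
      rw [← htop] at hleft hright
      have hα := hd.wordHeight_nonneg α
      have hβ := hd.wordHeight_nonneg β
      rw [← wordSum_perm hsweep.perm]
      simp only [Set.mem_Icc, add_wordSum_snd, wordHeight_append] at hy ⊢
      exact ⟨⟨by linarith, by linarith⟩, hleft.trans_le hx.1, hx.2.trans
        (hright.symm.trans_le (hsweep.weakLE.pathX_le hd hM hsweep.perm a q.2))⟩
    · obtain ⟨hy, hx⟩ := ih hM hP
      exact ⟨hy, ((R.append_leftWord_append_weakLE α β).pathX_le hd hnd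
        (R.append_leftWord_append_perm α β) a q.2).trans hx.1, hx.2⟩

theorem slice_subset (hd : IsEdgeSystem d) (h : Sweep d a L Ts M) (hM : M.Nodup)
    {P : ElnitskyPolygon n} (hP : P ∈ Ts) (y : ℝ) :
    P.slice d y ⊆ Set.Ioo (pathX d a L y) (pathX d a M y) := by
  intro x hx
  have hlt := hx.1.trans hx.2
  have hl := h.mem_Icc_of_mem_region hd hM hP (ElnitskyPolygon.mem_region_of_leftX_lt hd hlt
    (Set.left_mem_Icc.2 hlt.le))
  have hr := h.mem_Icc_of_mem_region hd hM hP (ElnitskyPolygon.mem_region_of_leftX_lt hd hlt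
    (Set.right_mem_Icc.2 hlt.le))
  exact ⟨hl.2.1.trans_lt hx.1, hx.2.trans_le hr.2.2⟩

theorem Ioc_subset (hd : IsEdgeSystem d) (h : Sweep d a L Ts M) (y : ℝ) :
    Set.Ioc (pathX d a L y) (pathX d a M y) ⊆ ⋃ P ∈ Ts, Set.Ioc (P.leftX d y) (P.rightX d y) := by
  induction h with
  | nil => simp
  | @cons R α β htop Ts M _ ih =>
    intro x hx
    simp only [Set.mem_iUnion₂, List.mem_cons, exists_prop, exists_eq_or_imp]
    rcases le_or_gt x (pathX d a (α ++ R.word ++ β) y) with hle | hlt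
    · rcases R.pathX_append_leftWord_append hd htop β y with ⟨-, hl, hr⟩ | ⟨heq, -⟩
      · exact Or.inl ⟨hl ▸ hx.1, hr ▸ hle⟩
      · exact absurd (heq ▸ hle) hx.1.not_ge
    · obtain ⟨P, hP, hxP⟩ := Set.mem_iUnion₂.1 (ih ⟨hlt, hx.2⟩)
      exact Or.inr ⟨P, hP, hxP⟩

theorem pairwise_disjoint (hd : IsEdgeSystem d) (h : Sweep d a L Ts M) (hM : M.Nodup) :
    Ts.Pairwise fun P Q => Disjoint (P.region d) (interior (Q.region d)) ∧
      Disjoint (Q.region d) (interior (P.region d)) := by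
  induction h with
  | nil => simp
  | @cons R α β htop Ts M hsweep ih =>
    refine List.pairwise_cons.2 ⟨fun Q hQ => ?_, ih hM⟩
    have hR {q : ℝ × ℝ} (hq : q ∈ R.region d) :
        R.rightX d q.2 = pathX d a (α ++ R.word ++ β) q.2 := by
      have hy := ((ElnitskyPolygon.mem_region hd).1 hq).1
      rw [ElnitskyPolygon.bottom, htop] at hy
      rw [hd.pathX_append_append a α R.word β hy, ElnitskyPolygon.rightX, htop]
    simp only [Set.disjoint_left]
    constructor
    · intro q hq hq'
      have hx := (hsweep.slice_subset hd hM hQ q.2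
        ((ElnitskyPolygon.mem_interior_region hd).1 hq')).1
      rw [← hR hq] at hx
      exact hx.not_ge ((ElnitskyPolygon.mem_region hd).1 hq).2.2
    · intro q hq hq'
      have hx := ((ElnitskyPolygon.mem_interior_region hd).1 hq').2
      rw [hR (interior_subset hq')] at hx
      exact hx.not_ge (hsweep.mem_Icc_of_mem_region hd hM hQ hq).2.1

theorem disjoint_of_ne (hd : IsEdgeSystem d) (h : Sweep d a L Ts M) (hM : M.Nodup)
    {P Q : ElnitskyPolygon n} (hP : P ∈ Ts) (hQ : Q ∈ Ts) (hne : P ≠ Q) :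
    Disjoint (P.region d) (interior (Q.region d)) := by
  have : Std.Symm fun P Q : ElnitskyPolygon n => Disjoint (P.region d) (interior (Q.region d)) ∧
      Disjoint (Q.region d) (interior (P.region d)) := ⟨fun _ _ h => h.symm⟩
  exact ((h.pairwise_disjoint hd hM).forall hP hQ hne).1

theorem exists_chain (h : Sweep d a L Ts M) :
    ∃ W : Set (List (Fin n)), IsChain WeakLE W ∧ L ∈ W ∧ M ∈ W ∧
      (∀ c ∈ W, c.Perm M ∧ WeakLE L c) ∧
      ∀ P ∈ Ts, ∃ α β, P.top = a + wordSum d α ∧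
        α ++ P.leftWord ++ β ∈ W ∧ α ++ P.word ++ β ∈ W := by
  induction h with
  | nil L => exact ⟨{L}, IsChain.singleton, rfl, rfl, by simp [WeakLE.refl], by simp⟩
  | @cons R α β htop Ts M hsweep ih =>
    obtain ⟨W, hchain, hL, hM, hW, hTs⟩ := ih
    have hle := R.append_leftWord_append_weakLE α β
    refine ⟨insert (α ++ R.leftWord ++ β) W,
      hchain.insert fun c hc _ => Or.inl (hle.trans (hW c hc).2), Set.mem_insert _ _,
      Set.mem_insert_of_mem _ hM, ?_, ?_⟩
    · rintro c (rfl | hc)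
      · exact ⟨(R.append_leftWord_append_perm α β).trans hsweep.perm, WeakLE.refl _⟩
      · exact ⟨(hW c hc).1, hle.trans (hW c hc).2⟩
    · rintro P hP
      rcases List.mem_cons.1 hP with rfl | hP
      · exact ⟨α, β, htop, Set.mem_insert _ _, Set.mem_insert_of_mem _ hL⟩
      · obtain ⟨γ, δ, hPtop, hl, hr⟩ := hTs P hP
        exact ⟨γ, δ, hPtop, Set.mem_insert_of_mem _ hl, Set.mem_insert_of_mem _ hr⟩

end Sweep

theorem WeakLE.exists_sweep (d : Fin n → ℝ × ℝ) (a : ℝ × ℝ) {L L' : List (Fin n)}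
    (h : WeakLE L L') (hL' : L'.Nodup) (hp : L.Perm L') :
    ∃ Ts, Sweep d a L Ts L' ∧ ∀ P ∈ Ts, P.IsRhombus := by
  refine WeakLE.induction_ascent hL' (C := fun L => ∃ Ts, Sweep d a L Ts L' ∧
    ∀ P ∈ Ts, P.IsRhombus) ⟨[], .nil _, by simp⟩ ?_ hp h
  rintro α i j β hij - - ⟨Ts, hsweep, hTs⟩
  let P : ElnitskyPolygon n := ⟨a + wordSum d α, [j, i], by simp [hij.ne']⟩
  have hleft : P.leftWord = [i, j] := ElnitskyPolygon.leftWord_of_word_eq_pair hij rfl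
  have hcons := Sweep.cons P α β rfl (by simpa [P] using hsweep)
  rw [hleft] at hcons
  exact ⟨P :: Ts, by simpa using hcons,
    List.forall_mem_cons.2 ⟨ElnitskyPolygon.isRhombus_iff.2 ⟨i, j, hij, rfl⟩, hTs⟩⟩

theorem pathVertices_subset_append (a : ℝ × ℝ) (α L β : List (Fin n)) :
    pathVertices d (a + wordSum d α) L ⊆ pathVertices d a (α ++ L ++ β) := by
  intro q hq
  obtain ⟨γ, δ, rfl, rfl⟩ := mem_pathVertices.1 hq
  exact mem_pathVertices.2 ⟨α ++ γ, δ ++ β, by simp, by rw [wordSum_append, add_assoc]⟩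

theorem pathEdges_subset_append (a : ℝ × ℝ) (α L β : List (Fin n)) :
    pathEdges d (a + wordSum d α) L ⊆ pathEdges d a (α ++ L ++ β) := by
  intro e he
  obtain ⟨γ, δ, hL, htop⟩ := mem_pathEdges.1 he
  exact mem_pathEdges.2 ⟨α ++ γ, δ ++ β, by simp [hL], by rw [htop, wordSum_append, add_assoc]⟩

theorem Sweep.notMem_openSegment (hd : IsEdgeSystem d) {R : ElnitskyPolygon n}
    {Ts : List (ElnitskyPolygon n)} (h : Sweep d R.top R.leftWord Ts R.word)
    {P Q : ElnitskyPolygon n} (hP : P ∈ insert R {P | P ∈ Ts}) (hQ : Q ∈ insert R {P | P ∈ Ts})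
    {x : ℝ × ℝ} (hx : x ∈ P.vertices d) {e : (ℝ × ℝ) × Fin n} (he : e ∈ Q.edges d) :
    x ∉ openSegment ℝ e.1 (e.1 + d e.2) := by
  obtain ⟨W, hchain, hL, hM, hW, hTs⟩ := h.exists_chain
  have hmem : ∀ P ∈ insert R {P | P ∈ Ts}, ∃ α β, P.top = R.top + wordSum d α ∧
      α ++ P.leftWord ++ β ∈ W ∧ α ++ P.word ++ β ∈ W := by
    rintro P (rfl | hP)
    · exact ⟨[], [], by simp [wordSum], by simpa using hL, by simpa using hM⟩
    · exact hTs P hP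
  obtain ⟨c, hc, hxc⟩ : ∃ c ∈ W, x ∈ pathVertices d R.top c := by
    obtain ⟨α, β, htop, hl, hr⟩ := hmem P hP
    rw [ElnitskyPolygon.vertices, htop, List.mem_append] at hx
    exact hx.elim (fun hx => ⟨_, hl, pathVertices_subset_append _ α _ β hx⟩)
      fun hx => ⟨_, hr, pathVertices_subset_append _ α _ β hx⟩
  obtain ⟨c', hc', hec⟩ : ∃ c' ∈ W, e ∈ pathEdges d R.top c' := by
    obtain ⟨α, β, htop, hl, hr⟩ := hmem Q hQ
    rw [ElnitskyPolygon.edges, ElnitskyPolygon.leftEdges, ElnitskyPolygon.rightEdges, htop,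
      List.mem_append] at he
    exact he.elim (fun he => ⟨_, hl, pathEdges_subset_append _ α _ β he⟩)
      fun he => ⟨_, hr, pathEdges_subset_append _ α _ β he⟩
  have hcomp : WeakLE c c' ∨ WeakLE c' c := by
    rcases eq_or_ne c c' with rfl | hne
    · exact Or.inl (WeakLE.refl c)
    · exact hchain hc hc' hne
  exact WeakLE.notMem_openSegment hd hcomp ((hW c' hc').1.nodup_iff.2 R.nodup)
    ((hW c hc).1.trans (hW c' hc').1.symm) hxc hec

theorem Sweep.isPawTiling (hd : IsEdgeSystem d) {w : Equiv.Perm (Fin n)}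
    {Ts : List (ElnitskyPolygon n)}
    (h : Sweep d 0 (elnitskyX w).leftWord Ts (elnitskyX w).word) :
    IsPawTiling d w {P | P ∈ Ts} where
  finite := List.finite_toSet Ts
  subset P hP q hq := (ElnitskyPolygon.mem_region hd).2
    (h.mem_Icc_of_mem_region hd (elnitskyX w).nodup hP hq)
  cover q hq := by
    obtain ⟨hy, hl, hr⟩ := (ElnitskyPolygon.mem_region hd).1 hq
    rcases hl.eq_or_lt with heq | hlt
    · refine Or.inl (Or.inl (hd.mem_pathPoints.2 ⟨?_, heq.symm⟩))
      rwa [wordSum_perm (elnitskyX w).leftWord_perm]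
    · obtain ⟨P, hP, hx⟩ := Set.mem_iUnion₂.1 (h.Ioc_subset hd q.2 ⟨hlt, hr⟩)
      exact Or.inr (Set.mem_biUnion hP (ElnitskyPolygon.mem_region_of_leftX_lt hd
        (hx.1.trans_le hx.2) (Set.Ioc_subset_Icc_self hx)))
  nonoverlapping P hP Q hQ hne := h.disjoint_of_ne hd (elnitskyX w).nodup hP hQ hne
  edge_to_edge _ hP _ hQ _ hx _ he := h.notMem_openSegment hd hP hQ hx he

end Sweep

/-! ### The leftmost of finitely many disjoint curves -/

section Leftmost

theorem lt_of_lt_of_forall_ne {s : Set ℝ} (hs : s.OrdConnected) {f g : ℝ → ℝ} (hf : Continuous f)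
    (hg : Continuous g) (hne : ∀ y ∈ s, f y ≠ g y) {y z : ℝ} (hy : y ∈ s) (hz : z ∈ s)
    (hlt : f y < g y) : f z < g z := by
  by_contra! hle
  obtain ⟨x, hx, heq⟩ := hs.isPreconnected.intermediate_value₂ hy hz hf.continuousOn
    hg.continuousOn hlt.le hle
  exact hne x hx heq

variable {ι : Type*} {f : ι → ℝ → ℝ} {b t : ι → ℝ}

/-- All curves that share heights with the curve `X` share the heights just above its bottom, where
they are totally ordered. -/
theorem forall_le_of_lt_leftmost {s : Finset ι} {X m : ι} (hm : m ∈ s)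
    (hf : ∀ i, Continuous (f i)) (hmax : ∀ i ∈ s, b i ≤ b X)
    (hne : ∀ i ∈ s, ∀ y ∈ Set.Ioo (b X) (t X) ∩ Set.Ioo (b i) (t i), f X y ≠ f i y)
    (hmin : ∀ i ∈ s, ∀ y ∈ Set.Ioo (b m) (t m) ∩ Set.Ioo (b i) (t i), f m y ≤ f i y)
    {y : ℝ} (hy : y ∈ Set.Ioo (b X) (t X) ∩ Set.Ioo (b m) (t m)) (hlt : f X y < f m y) :
    ∀ i ∈ s, ∀ z ∈ Set.Ioo (b X) (t X) ∩ Set.Ioo (b i) (t i), f X z ≤ f i z := by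
  intro i hi z hz
  obtain ⟨x, hbx, hx⟩ := exists_between (lt_min hy.1.1 hz.1.1)
  rw [lt_min_iff] at hx
  have hxX : x ∈ Set.Ioo (b X) (t X) := ⟨hbx, hx.1.trans hy.1.2⟩
  have hxm : x ∈ Set.Ioo (b m) (t m) := ⟨(hmax m hm).trans_lt hbx, hx.1.trans hy.2.2⟩
  have hxi : x ∈ Set.Ioo (b i) (t i) := ⟨(hmax i hi).trans_lt hbx, hx.2.trans hz.2.2⟩
  have hconn (i : ι) : (Set.Ioo (b X) (t X) ∩ Set.Ioo (b i) (t i)).OrdConnected :=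
    Set.ordConnected_Ioo.inter Set.ordConnected_Ioo
  have hXm : f X x < f m x :=
    lt_of_lt_of_forall_ne (hconn m) (hf X) (hf m) (hne m hm) hy ⟨hxX, hxm⟩ hlt
  exact (lt_of_lt_of_forall_ne (hconn i) (hf X) (hf i) (hne i hi) ⟨hxX, hxi⟩ hz
    (hXm.trans_le (hmin i hi x ⟨hxm, hxi⟩))).le

theorem exists_leftmost (s : Finset ι) (hs : s.Nonempty) (hf : ∀ i, Continuous (f i))
    (hne : ∀ i ∈ s, ∀ j ∈ s, i ≠ j →
      ∀ y ∈ Set.Ioo (b i) (t i) ∩ Set.Ioo (b j) (t j), f i y ≠ f j y) :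
    ∃ m ∈ s, ∀ i ∈ s, ∀ y ∈ Set.Ioo (b m) (t m) ∩ Set.Ioo (b i) (t i), f m y ≤ f i y := by
  classical
  induction s using Finset.induction_on_max_value b with
  | empty => exact absurd hs Finset.not_nonempty_empty
  | insert X s hX hmax ih =>
    rcases s.eq_empty_or_nonempty with rfl | hs'
    · exact ⟨X, by simp, by simp⟩
    have hmem {i : ι} : i ∈ s → i ∈ insert X s := Finset.mem_insert_of_mem
    obtain ⟨m, hm, hmin⟩ := ih hs' fun i hi j hj => hne i (hmem hi) j (hmem hj)
    by_cases hleft : ∃ y ∈ Set.Ioo (b X) (t X) ∩ Set.Ioo (b m) (t m), f X y < f m y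
    · obtain ⟨y, hy, hlt⟩ := hleft
      have hX' := Finset.mem_insert_self X s
      exact ⟨X, hX', (Finset.forall_mem_insert ..).2 ⟨fun _ _ => le_rfl,
        forall_le_of_lt_leftmost hm hf hmax (fun i hi => hne X hX' i (hmem hi)
          (ne_of_mem_of_not_mem hi hX).symm) hmin hy hlt⟩⟩
    · push Not at hleft
      exact ⟨m, hmem hm, (Finset.forall_mem_insert ..).2 ⟨fun y hy => hleft y hy.symm, hmin⟩⟩

end Leftmost

/-! ### A path contained in another path is given by a subword -/

section Alignment

variable {n : ℕ} {d : Fin n → ℝ × ℝ}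

namespace IsEdgeSystem

variable (hd : IsEdgeSystem d)
include hd

theorem eq_of_pathX_cons_eq {a v : ℝ × ℝ} {i j : Fin n}
    {L M : List (Fin n)} {y z : ℝ} (hyz : y < z)
    (ha : Set.Icc y z ⊆ Set.Icc (a + d i).2 a.2) (hv : Set.Icc y z ⊆ Set.Icc (v + d j).2 v.2)
    (heq : Set.EqOn (pathX d a (i :: L)) (pathX d v (j :: M)) (Set.Icc y z)) : i = j := by
  have hline {a : ℝ × ℝ} {i : Fin n} (L : List (Fin n)) {x : ℝ}
      (hx : x ∈ Set.Icc (a + d i).2 a.2) :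
      pathX d a (i :: L) x = a.1 + edgeSlope d i * (a.2 - x) := by
    have hsnd : (a + d i).2 = a.2 - edgeHeight d i := by simp [edgeHeight]
    rw [hsnd] at hx
    simpa using hd.pathX_cons a i L (r := a.2 - x) (by linarith [hx.2]) (by linarith [hx.1])
  have hy := Set.left_mem_Icc.2 hyz.le
  have hz := Set.right_mem_Icc.2 hyz.le
  have heqy := heq hy
  have heqz := heq hz
  rw [hline L (ha hy), hline M (hv hy)] at heqy
  rw [hline L (ha hz), hline M (hv hz)] at heqz
  refine hd.strictMono_edgeSlope.injective (mul_right_cancel₀ (sub_pos.2 hyz).ne' ?_)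
  linarith

theorem exists_append_of_eqOn {L M : List (Fin n)} {a : ℝ × ℝ}
    (hbot : (a + wordSum d L).2 ≤ (a + wordSum d M).2)
    (heq : Set.EqOn (pathX d a L) (pathX d a M) (Set.Icc (a + wordSum d M).2 a.2)) :
    ∃ β, L = M ++ β := by
  induction M generalizing L a with
  | nil => exact ⟨L, rfl⟩
  | cons j M ih =>
    obtain ⟨i, L, rfl⟩ := List.exists_cons_of_ne_nil (l := L) fun hnil => by
      have := hd.add_wordSum_snd_lt a (List.cons_ne_nil j M)
      rw [hnil, add_wordSum_nil] at hbot
      exact this.not_ge hbot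
    rw [add_wordSum_cons] at hbot heq
    rw [add_wordSum_cons] at hbot
    obtain rfl : i = j := hd.eq_of_pathX_cons_eq
      (max_lt (hd.add_snd_lt a i) (hd.add_snd_lt a j))
      (Set.Icc_subset_Icc_left (le_max_left _ _)) (Set.Icc_subset_Icc_left (le_max_right _ _))
      (heq.mono (Set.Icc_subset_Icc_left ((hd.add_wordSum_snd_le _ M).trans (le_max_right _ _))))
    obtain ⟨β, rfl⟩ := ih hbot fun y hy => by
      rw [← hd.pathX_cons_of_le a i L hy.2, ← hd.pathX_cons_of_le a i M hy.2]
      exact heq ⟨hy.1, hy.2.trans (hd.add_snd_lt a i).le⟩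
    exact ⟨β, rfl⟩

/-- If `v` is inside the first edge `i`, then the first edge of `M` is also labelled `i` and goes
straight on below this edge. -/
theorem not_eqOn_of_lt_of_lt {i j : Fin n} {L M : List (Fin n)} (hiL : i ∉ L) {a v : ℝ × ℝ}
    (hhigh : (a + d i).2 < v.2) (hbelow : v.2 < a.2)
    (hbot : (a + d i + wordSum d L).2 ≤ (v + d j + wordSum d M).2) :
    ¬ Set.EqOn (pathX d a (i :: L)) (pathX d v (j :: M))
      (Set.Icc (v + d j + wordSum d M).2 v.2) := by
  intro heq
  have hMj := hd.add_wordSum_snd_le (v + d j) M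
  obtain rfl : i = j := hd.eq_of_pathX_cons_eq (max_lt hhigh (hd.add_snd_lt v j))
    (Set.Icc_subset_Icc (le_max_left _ _) hbelow.le) (Set.Icc_subset_Icc_left (le_max_right _ _))
    (heq.mono (Set.Icc_subset_Icc_left (hMj.trans (le_max_right _ _))))
  have hlong : (v + d i).2 < (a + d i).2 := by simpa using hbelow
  obtain ⟨k, L, rfl⟩ := List.exists_cons_of_ne_nil (l := L) fun hnil => by
    rw [hnil, add_wordSum_nil] at hbot
    exact (hbot.trans hMj).not_gt hlong
  refine List.ne_of_not_mem_cons hiL (hd.eq_of_pathX_cons_eq (L := L) (M := M)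
    (max_lt (hd.add_snd_lt (a + d i) k) hlong)
    (Set.Icc_subset_Icc_left (le_max_left _ _))
    (Set.Icc_subset_Icc (le_max_right _ _) hhigh.le) fun y hy => ?_).symm
  rw [← hd.pathX_cons_of_le a i _ hy.2]
  exact heq ⟨(hMj.trans (le_max_right _ _)).trans hy.1, hy.2.trans hhigh.le⟩

theorem exists_append_append_of_eqOn_Icc {L M : List (Fin n)} (hL : L.Nodup) (hM : M ≠ [])
    {a v : ℝ × ℝ} (htop : v.2 ≤ a.2) (hbot : (a + wordSum d L).2 ≤ (v + wordSum d M).2)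
    (heq : Set.EqOn (pathX d a L) (pathX d v M) (Set.Icc (v + wordSum d M).2 v.2)) :
    ∃ α β, L = α ++ M ++ β ∧ v = a + wordSum d α := by
  have hvM := hd.add_wordSum_snd_lt v hM
  induction L generalizing a with
  | nil => exact absurd (hbot.trans_lt hvM) (by simpa [wordSum] using htop)
  | cons i L ih =>
    obtain ⟨j, M, rfl⟩ := List.exists_cons_of_ne_nil hM
    rcases htop.eq_or_lt with htop | hbelow
    · obtain rfl : v = a := Prod.ext (by
        have := heq (Set.right_mem_Icc.2 hvM.le)
        rwa [hd.pathX_of_top_le _ htop.ge, hd.pathX_of_top_le _ le_rfl, eq_comm] at this) htop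
      obtain ⟨β, hβ⟩ := hd.exists_append_of_eqOn hbot heq
      exact ⟨[], β, hβ, (add_wordSum_nil v).symm⟩
    obtain ⟨hiL, hL⟩ := List.nodup_cons.1 hL
    rw [add_wordSum_cons a] at hbot
    rcases le_or_gt v.2 (a + d i).2 with hlow | hhigh
    · obtain ⟨α, β, rfl, rfl⟩ := ih hL hlow hbot fun y hy => by
        rw [← hd.pathX_cons_of_le a i L (hy.2.trans hlow), heq hy]
      exact ⟨i :: α, β, by simp, by rw [add_wordSum_cons]⟩
    rw [add_wordSum_cons v] at hbot heq
    exact (hd.not_eqOn_of_lt_of_lt hiL hhigh hbelow hbot heq).elim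

theorem exists_append_append_of_eqOn {L M : List (Fin n)} (hL : L.Nodup) (hM : M ≠ [])
    {a v : ℝ × ℝ} (htop : v.2 ≤ a.2) (hbot : (a + wordSum d L).2 ≤ (v + wordSum d M).2)
    (heq : Set.EqOn (pathX d a L) (pathX d v M) (Set.Ioo (v + wordSum d M).2 v.2)) :
    ∃ α β, L = α ++ M ++ β ∧ v = a + wordSum d α := by
  refine hd.exists_append_append_of_eqOn_Icc hL hM htop hbot ?_
  rw [← closure_Ioo (hd.add_wordSum_snd_lt v hM).ne]
  exact heq.closure (continuous_pathX a L) (continuous_pathX v M)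

end IsEdgeSystem

end Alignment

/-! ### Rhombic fillings -/

section Filling

variable {n : ℕ} {d : Fin n → ℝ × ℝ}

theorem ElnitskyPolygon.IsRhombus.leftX_lt_rightX (hd : IsEdgeSystem d) {P : ElnitskyPolygon n}
    (hP : P.IsRhombus) {y : ℝ} (hy : y ∈ Set.Ioo (P.bottom d).2 P.top.2) :
    P.leftX d y < P.rightX d y := by
  refine (leftX_le_rightX hd y).lt_of_ne fun heq => ?_
  obtain ⟨i, j, hij, hword⟩ := isRhombus_iff.1 hP
  have hleft := leftWord_of_word_eq_pair hij hword
  have hused := ((P.leftWord_weakLE P.word).accum_edgeSlope_le hd P.nodup P.leftWord_perm _).2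
    (add_left_cancel heq)
  have hnd := P.nodup
  rw [bottom, add_wordSum_snd] at hy
  rw [hword] at hused hy hnd
  rw [hleft] at hused
  have ht : 0 < P.top.2 - y := by linarith [hy.2]
  have hj : 0 < usedHeight d [j, i] (P.top.2 - y) j := by
    rw [usedHeight_cons_self]
    exact add_pos_of_pos_of_nonneg (lt_max_of_lt_right (lt_min ht (hd.edgeHeight_pos j)))
      (usedHeight_nonneg _ _ _)
  have hi : usedHeight d [i, j] (P.top.2 - y) i = edgeHeight d i :=
    hd.usedHeight_of_pair_sublist (by simp [hij.ne]) (List.Sublist.refl _) (hused ▸ hj)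
  have hj' : usedHeight d [j, i] (P.top.2 - y) j = edgeHeight d j :=
    hd.usedHeight_of_pair_sublist hnd (List.Sublist.refl _)
      (by rw [← hused, hi]; exact hd.edgeHeight_pos i)
  have hsum := hd.sum_usedHeight [j, i] (P.top.2 - y)
  rw [max_eq_right (le_min ht.le (hd.wordHeight_nonneg _)), min_eq_left (by linarith [hy.1]),
    Finset.sum_eq_add_of_mem i j (Finset.mem_univ _) (Finset.mem_univ _) hij.ne
      fun l _ hl => usedHeight_of_notMem (by simp [hl.1, hl.2]) _, hj', ← hused, hi] at hsum
  simp only [wordHeight, List.map_cons, List.map_nil, List.sum_cons, List.sum_nil] at hy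
  linarith [hy.1]

theorem ElnitskyPolygon.IsRhombus.midX_mem_slice (hd : IsEdgeSystem d) {P : ElnitskyPolygon n}
    (hP : P.IsRhombus) {y : ℝ} (hy : y ∈ Set.Ioo (P.bottom d).2 P.top.2) :
    P.midX d y ∈ P.slice d y :=
  have hlt := hP.leftX_lt_rightX hd hy
  ⟨left_lt_add_div_two.2 hlt, add_div_two_lt_right.2 hlt⟩

/-- The rhombi in `U` fill the space between the paths of `L` and `G` with top `a`. At each height,
finitely many points may remain uncovered. -/
structure IsRhombicFilling (d : Fin n → ℝ × ℝ) (a : ℝ × ℝ) (L G : List (Fin n))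
    (U : Finset (ElnitskyPolygon n)) : Prop where
  perm : L.Perm G
  le (y : ℝ) : pathX d a L y ≤ pathX d a G y
  isRhombus : ∀ P ∈ U, P.IsRhombus
  slice_subset : ∀ P ∈ U, ∀ y, P.slice d y ⊆ Set.Ioo (pathX d a L y) (pathX d a G y)
  disjoint : ∀ P ∈ U, ∀ Q ∈ U, P ≠ Q → ∀ y, Disjoint (P.slice d y) (Q.slice d y)
  finite_diff (y : ℝ) :
    (Set.Ioo (pathX d a L y) (pathX d a G y) \ ⋃ P ∈ U, P.slice d y).Finite

/-- The path of `M` with top `v` runs between the paths of `L` and `G` with top `a` and does not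
enter the polygons in `U`. -/
structure IsSeparatingPath (d : Fin n → ℝ × ℝ) (a : ℝ × ℝ) (L G : List (Fin n))
    (U : Finset (ElnitskyPolygon n)) (v : ℝ × ℝ) (M : List (Fin n)) : Prop where
  top_le : v.2 ≤ a.2
  le_bottom : (a + wordSum d G).2 ≤ (v + wordSum d M).2
  mem_Icc : ∀ y ∈ Set.Ioo (v + wordSum d M).2 v.2,
    pathX d v M y ∈ Set.Icc (pathX d a L y) (pathX d a G y)
  notMem_slice : ∀ y ∈ Set.Ioo (v + wordSum d M).2 v.2, ∀ P ∈ U, pathX d v M y ∉ P.slice d y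

variable {a v : ℝ × ℝ} {L G M : List (Fin n)} {U : Finset (ElnitskyPolygon n)}

theorem IsSeparatingPath.erase [DecidableEq (ElnitskyPolygon n)] (hd : IsEdgeSystem d)
    {α β : List (Fin n)} {R : ElnitskyPolygon n}
    (hM : IsSeparatingPath d a (α ++ R.leftWord ++ β) G U v M)
    (htop : R.top = a + wordSum d α)
    (hR : ∀ y ∈ Set.Ioo (R.bottom d).2 R.top.2, y ∈ Set.Ioo (v + wordSum d M).2 v.2 →
      R.rightX d y ≤ pathX d v M y) :
    IsSeparatingPath d a (α ++ R.word ++ β) G (U.erase R) v M where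
  top_le := hM.top_le
  le_bottom := hM.le_bottom
  mem_Icc y hy := by
    refine ⟨?_, (hM.mem_Icc y hy).2⟩
    rcases R.pathX_append_leftWord_append hd htop β y with ⟨hlt, -, hr⟩ | ⟨heq, -⟩
    · exact hr ▸ hR y (R.mem_Ioo_of_leftX_lt_rightX hd hlt) hy
    · exact heq ▸ (hM.mem_Icc y hy).1
  notMem_slice y hy P hP := hM.notMem_slice y hy P (Finset.mem_of_mem_erase hP)

namespace IsRhombicFilling

theorem le_pathX (h : IsRhombicFilling d a L G U) {x y : ℝ} (hx : x ≤ pathX d a G y)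
    (hU : ∀ P ∈ U, ∀ z ∈ P.slice d y, x ≤ z) : x ≤ pathX d a L y := by
  by_contra! hlt
  refine Set.Ioo_infinite hlt ((h.finite_diff y).subset fun z hz =>
    ⟨⟨hz.1, hz.2.trans_le hx⟩, ?_⟩)
  simp only [Set.mem_iUnion₂, not_exists]
  exact fun P hP hzP => (hU P hP z hzP).not_gt hz.2

theorem border_mem_Icc (h : IsRhombicFilling d a L G U) {P : ElnitskyPolygon n} (hP : P ∈ U)
    {y : ℝ} (hy : P.leftX d y < P.rightX d y) :
    pathX d a L y ≤ P.leftX d y ∧ P.rightX d y ≤ pathX d a G y :=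
  (Set.Ioo_subset_Ioo_iff hy).1 (h.slice_subset P hP y)

/-- The midline of a rhombus does not meet the separating path or another rhombus of the filling, so
the separating path and the midlines are disjoint curves. -/
theorem exists_leftmost_curve (hd : IsEdgeSystem d) (h : IsRhombicFilling d a L G U)
    (hM : IsSeparatingPath d a L G U v M) :
    (∀ P ∈ U, ∀ y ∈ Set.Ioo (v + wordSum d M).2 v.2 ∩ Set.Ioo (P.bottom d).2 P.top.2,
      pathX d v M y ≤ P.midX d y) ∨
    ∃ R ∈ U,
      (∀ P ∈ U, ∀ y ∈ Set.Ioo (R.bottom d).2 R.top.2 ∩ Set.Ioo (P.bottom d).2 P.top.2,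
        R.midX d y ≤ P.midX d y) ∧
      ∀ y ∈ Set.Ioo (R.bottom d).2 R.top.2 ∩ Set.Ioo (v + wordSum d M).2 v.2,
        R.midX d y ≤ pathX d v M y := by
  obtain ⟨m, hm, hmin⟩ := exists_leftmost (Finset.insertNone U) ⟨none, by simp⟩
    (f := fun o => o.elim (pathX d v M) fun P => P.midX d)
    (b := fun o => o.elim (v + wordSum d M).2 fun P => (P.bottom d).2)
    (t := fun o => o.elim v.2 fun P => P.top.2)
    (by
      rintro (_ | P)
      · exact continuous_pathX v M
      · exact ElnitskyPolygon.continuous_midX)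
    (by
      rintro (_ | P) hP (_ | Q) hQ hPQ y ⟨hy, hy'⟩ heq <;>
        simp only [Finset.some_mem_insertNone, Option.elim] at hP hQ hy hy' heq
      · exact hPQ rfl
      · exact hM.notMem_slice y hy Q hQ (heq ▸ (h.isRhombus Q hQ).midX_mem_slice hd hy')
      · exact hM.notMem_slice y hy' P hP (heq ▸ (h.isRhombus P hP).midX_mem_slice hd hy)
      · exact Set.disjoint_left.1 (h.disjoint P hP Q hQ (by simpa using hPQ) y)
          ((h.isRhombus P hP).midX_mem_slice hd hy)
          (heq ▸ (h.isRhombus Q hQ).midX_mem_slice hd hy'))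
  rcases m with _ | R
  · exact Or.inl fun P hP => hmin (some P) (by simpa using hP)
  · exact Or.inr ⟨R, by simpa using hm, fun P hP => hmin (some P) (by simpa using hP),
      hmin none (by simp)⟩

/-- Nothing fits between the leftmost curve and the path of `L`. -/
theorem eqOn_or_exists_eqOn (hd : IsEdgeSystem d) (h : IsRhombicFilling d a L G U)
    (hM : IsSeparatingPath d a L G U v M) :
    Set.EqOn (pathX d a L) (pathX d v M) (Set.Ioo (v + wordSum d M).2 v.2) ∨
      ∃ R ∈ U, Set.EqOn (pathX d a L) (R.leftX d) (Set.Ioo (R.bottom d).2 R.top.2) ∧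
        ∀ y ∈ Set.Ioo (R.bottom d).2 R.top.2, y ∈ Set.Ioo (v + wordSum d M).2 v.2 →
          R.rightX d y ≤ pathX d v M y := by
  have hmem {P : ElnitskyPolygon n} {x y : ℝ} (hx : x ∈ P.slice d y) :
      y ∈ Set.Ioo (P.bottom d).2 P.top.2 :=
    ElnitskyPolygon.mem_Ioo_of_leftX_lt_rightX hd (hx.1.trans hx.2)
  have hmid {P : ElnitskyPolygon n} (hP : P ∈ U) {y : ℝ}
      (hy : y ∈ Set.Ioo (P.bottom d).2 P.top.2) : P.midX d y ∈ P.slice d y :=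
    (h.isRhombus P hP).midX_mem_slice hd hy
  rcases h.exists_leftmost_curve hd hM with hmin | ⟨R, hR, hmin, hRM⟩
  · refine Or.inl fun y hy => (hM.mem_Icc y hy).1.antisymm
      (h.le_pathX (hM.mem_Icc y hy).2 fun P hP z hz => ?_)
    by_contra! hlt
    exact hM.notMem_slice y hy P hP
      ⟨hz.1.trans hlt, (hmin P hP y ⟨hy, hmem hz⟩).trans_lt (hmid hP (hmem hz)).2⟩
  · refine Or.inr ⟨R, hR, fun y hy => ?_, fun y hy hyM => ?_⟩
    · have hlt := (h.isRhombus R hR).leftX_lt_rightX hd hy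
      obtain ⟨hl, hr⟩ := h.border_mem_Icc hR hlt
      refine hl.antisymm (h.le_pathX (hlt.le.trans hr) fun P hP z hz => ?_)
      rcases eq_or_ne P R with rfl | hne
      · exact hz.1.le
      · by_contra! hzR
        exact Set.disjoint_left.1 (h.disjoint P hP R hR hne y)
          ⟨hz.1.trans (hzR.trans (hmid hR hy).1),
            (hmin P hP y ⟨hy, hmem hz⟩).trans_lt (hmid hP (hmem hz)).2⟩ (hmid hR hy)
    · by_contra! hlt
      exact hM.notMem_slice y hyM R hR ⟨(hmid hR hy).1.trans_le (hRM y ⟨hy, hyM⟩), hlt⟩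

theorem exists_append_leftWord_append (hd : IsEdgeSystem d) (hG : G.Nodup)
    (h : IsRhombicFilling d a L G U) {R : ElnitskyPolygon n} (hR : R ∈ U)
    (heq : Set.EqOn (pathX d a L) (R.leftX d) (Set.Ioo (R.bottom d).2 R.top.2)) :
    ∃ α β, L = α ++ R.leftWord ++ β ∧ R.top = a + wordSum d α := by
  have hsub : Set.Ioo (R.bottom d).2 R.top.2 ⊆ Set.Ioo (a + wordSum d G).2 a.2 := fun y hy => by
    have hlt := (h.isRhombus R hR).leftX_lt_rightX hd hy
    by_contra hy'
    have hLG := hd.pathX_eq_of_perm_of_notMem h.perm hy'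
    exact (hlt.trans_le (h.border_mem_Icc hR hlt).2).ne ((heq hy).symm.trans hLG)
  obtain ⟨i, j, -, hword⟩ := ElnitskyPolygon.isRhombus_iff.1 (h.isRhombus R hR)
  have hne : R.leftWord ≠ [] := fun hnil => by
    simpa [hnil, hword] using R.leftWord_perm
  have hsum : R.bottom d = R.top + wordSum d R.leftWord := by
    rw [ElnitskyPolygon.bottom, wordSum_perm R.leftWord_perm]
  rw [hsum] at hsub heq
  have hlt := hd.add_wordSum_snd_lt R.top hne
  obtain ⟨hbot, htop⟩ := (Set.Ioo_subset_Ioo_iff hlt).1 hsub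
  exact hd.exists_append_append_of_eqOn (h.perm.nodup_iff.2 hG) hne htop
    (by rwa [wordSum_perm h.perm]) heq

theorem erase [DecidableEq (ElnitskyPolygon n)] (hd : IsEdgeSystem d)
    {α β : List (Fin n)} {R : ElnitskyPolygon n}
    (h : IsRhombicFilling d a (α ++ R.leftWord ++ β) G U) (hR : R ∈ U)
    (htop : R.top = a + wordSum d α) :
    IsRhombicFilling d a (α ++ R.word ++ β) G (U.erase R) where
  perm := (R.append_leftWord_append_perm α β).symm.trans h.perm
  le y := by
    rcases R.pathX_append_leftWord_append hd htop β y with ⟨hlt, -, hr⟩ | ⟨heq, -⟩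
    · exact hr ▸ (h.border_mem_Icc hR hlt).2
    · exact heq ▸ h.le y
  isRhombus P hP := h.isRhombus P (Finset.mem_of_mem_erase hP)
  slice_subset P hP y x hx := by
    obtain ⟨hne, hPU⟩ := Finset.mem_erase.1 hP
    have hxL := h.slice_subset P hPU y hx
    rcases R.pathX_append_leftWord_append hd htop β y with ⟨hlt, hl, hr⟩ | ⟨heq, -⟩
    · rw [hl] at hxL
      refine ⟨lt_of_not_ge fun hle => ?_, hxL.2⟩
      have hPR : max (P.leftX d y) (R.leftX d y) ≤ P.leftX d y :=
        max_le le_rfl (hl ▸ (h.border_mem_Icc hPU (hx.1.trans hx.2)).1)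
      have hdisj := h.disjoint P hPU R hR hne y
      rw [ElnitskyPolygon.slice, ElnitskyPolygon.slice, Set.Ioo_disjoint_Ioo] at hdisj
      exact (lt_min (hPR.trans_lt (hx.1.trans hx.2))
        (hPR.trans_lt (hx.1.trans_le (hle.trans_eq hr)))).not_ge hdisj
    · exact heq ▸ hxL
  disjoint P hP Q hQ := h.disjoint P (Finset.mem_of_mem_erase hP) Q (Finset.mem_of_mem_erase hQ)
  finite_diff y := by
    refine (h.finite_diff y).subset ?_
    rintro x ⟨hx, hxU⟩
    rcases R.pathX_append_leftWord_append hd htop β y with ⟨hlt, hl, hr⟩ | ⟨heq, hR'⟩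
    · rw [hr] at hx
      refine ⟨⟨hl ▸ hlt.trans hx.1, hx.2⟩, fun hxU' => hxU ?_⟩
      obtain ⟨P, hP, hxP⟩ := Set.mem_iUnion₂.1 hxU'
      refine Set.mem_biUnion (Finset.mem_erase.2 ⟨?_, hP⟩) hxP
      rintro rfl
      exact hxP.2.not_gt hx.1
    · refine ⟨heq ▸ hx, fun hxU' => hxU ?_⟩
      obtain ⟨P, hP, hxP⟩ := Set.mem_iUnion₂.1 hxU'
      refine Set.mem_biUnion (Finset.mem_erase.2 ⟨?_, hP⟩) hxP
      rintro rfl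
      exact (hxP.1.trans hxP.2).ne hR'

theorem exists_append_append (hd : IsEdgeSystem d) (hG : G.Nodup)
    (h : IsRhombicFilling d a L G U) (hM : IsSeparatingPath d a L G U v M) (hne : M ≠ []) :
    ∃ α β, v = a + wordSum d α ∧ WeakLE L (α ++ M ++ β) ∧
      ∃ U', IsRhombicFilling d a (α ++ M ++ β) G U' := by
  classical
  induction U using Finset.strongInduction generalizing L with
  | H U ih =>
    rcases h.eqOn_or_exists_eqOn hd hM with heq | ⟨R, hR, heq, hRM⟩
    · obtain ⟨α, β, rfl, hv⟩ := hd.exists_append_append_of_eqOn (h.perm.nodup_iff.2 hG) hne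
        hM.top_le (by rw [wordSum_perm h.perm]; exact hM.le_bottom) heq
      exact ⟨α, β, hv, WeakLE.refl _, U, h⟩
    · obtain ⟨α, β, rfl, htop⟩ := h.exists_append_leftWord_append hd hG hR heq
      obtain ⟨γ, δ, hv, hle, hU'⟩ := ih (U.erase R) (Finset.erase_ssubset hR)
        (h.erase hd hR htop) (hM.erase hd htop hRM)
      exact ⟨γ, δ, hv, (R.append_leftWord_append_weakLE α β).trans hle, hU'⟩

theorem weakLE (hd : IsEdgeSystem d) (hG : G.Nodup) (h : IsRhombicFilling d a L G U) :
    WeakLE L G := by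
  rcases eq_or_ne G [] with rfl | hne
  · rw [h.perm.eq_nil]
    exact WeakLE.refl []
  have hsep : IsSeparatingPath d a L G U a G :=
    ⟨le_rfl, le_rfl, fun y _ => ⟨h.le y, le_rfl⟩,
      fun y _ P hP hmem => (h.slice_subset P hP y hmem).2.false⟩
  obtain ⟨α, β, -, hle, U', h'⟩ := h.exists_append_append hd hG hsep hne
  have hlen := h'.perm.length_eq
  simp only [List.length_append] at hlen
  obtain rfl : α = [] := List.length_eq_zero_iff.1 (by lia)
  obtain rfl : β = [] := List.length_eq_zero_iff.1 (by lia)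
  simpa using hle

end IsRhombicFilling

end Filling

/-! ### Paw tilings as rhombic fillings -/

section TilingToFilling

variable {n : ℕ} {d : Fin n → ℝ × ℝ} {w : Equiv.Perm (Fin n)} {T : Set (ElnitskyPolygon n)}
  {P Q : ElnitskyPolygon n}

theorem Sweep.finite_diff (hd : IsEdgeSystem d) {a : ℝ × ℝ} {L M : List (Fin n)}
    {Ts : List (ElnitskyPolygon n)} (h : Sweep d a L Ts M) (y : ℝ) :
    (Set.Ioo (pathX d a L y) (pathX d a M y) \ ⋃ P ∈ Ts, P.slice d y).Finite := by
  refine ((List.finite_toSet Ts).image fun P => P.rightX d y).subset ?_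
  rintro x ⟨hx, hxTs⟩
  obtain ⟨P, hP, hxP⟩ := Set.mem_iUnion₂.1 (h.Ioc_subset hd y (Set.Ioo_subset_Ioc_self hx))
  exact ⟨P, hP, hxP.2.antisymm' (not_lt.1 fun hlt => hxTs (Set.mem_biUnion hP ⟨hxP.1, hlt⟩))⟩

namespace IsPawTiling

theorem notMem_slice (hd : IsEdgeSystem d) (hT : IsPawTiling d w T) (hP : P ∈ T) (hQ : Q ∈ T)
    (hne : P ≠ Q) {q : ℝ × ℝ} (hq : q ∈ P.region d) : q.1 ∉ Q.slice d q.2 := fun hqQ =>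
  Set.disjoint_left.1 (hT.nonoverlapping P hP Q hQ hne) hq
    ((ElnitskyPolygon.mem_interior_region hd).2 hqQ)

theorem slice_subset (hd : IsEdgeSystem d) (hT : IsPawTiling d w T) (hP : P ∈ T) (y : ℝ) :
    P.slice d y ⊆ (elnitskyX w).slice d y := fun x hx =>
  (ElnitskyPolygon.mem_interior_region hd).1 (interior_mono (hT.subset P hP)
    ((ElnitskyPolygon.mem_interior_region hd (q := (x, y))).2 hx))

theorem finite_diff (hd : IsEdgeSystem d) (hT : IsPawTiling d w T) (y : ℝ) :
    ((elnitskyX w).slice d y \ ⋃ P ∈ T, P.slice d y).Finite := by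
  refine ((hT.finite.image fun P => P.leftX d y).union
    (hT.finite.image fun P => P.rightX d y)).subset ?_
  rintro x ⟨hx, hxT⟩
  rcases hT.cover (interior_subset ((ElnitskyPolygon.mem_interior_region hd (q := (x, y))).2 hx))
    with (hborder | hborder) | hpaw
  · exact absurd (hd.mem_pathPoints.1 hborder).2 hx.1.ne'
  · exact absurd (hd.mem_pathPoints.1 hborder).2 hx.2.ne
  · obtain ⟨P, hP, hxP⟩ := Set.mem_iUnion₂.1 hpaw
    obtain ⟨-, hl, hr⟩ := (ElnitskyPolygon.mem_region hd).1 hxP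
    rcases hl.eq_or_lt with heq | hl
    · exact Or.inl ⟨P, hP, heq⟩
    · exact Or.inr ⟨P, hP, hr.antisymm' (not_lt.1 fun hlt => hxT (Set.mem_biUnion hP ⟨hl, hlt⟩))⟩

theorem exists_isRhombicFilling (hd : IsEdgeSystem d) (hT : IsPawTiling d w T) :
    ∃ U, IsRhombicFilling d 0 (elnitskyX w).leftWord (elnitskyX w).word U ∧
      ∀ R ∈ U, ∃ P ∈ T, ∀ y, R.slice d y ⊆ P.slice d y := by
  classical
  choose Us hUs hrhombus using fun P : ElnitskyPolygon n =>
    (P.leftWord_weakLE P.word).exists_sweep d P.top P.nodup P.leftWord_perm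
  have hsub {P R : ElnitskyPolygon n} (hR : R ∈ Us P) (y : ℝ) : R.slice d y ⊆ P.slice d y :=
    (hUs P).slice_subset hd P.nodup hR y
  let U := hT.finite.toFinset.biUnion fun P => (Us P).toFinset
  have hmem {R : ElnitskyPolygon n} : R ∈ U ↔ ∃ P ∈ T, R ∈ Us P := by simp [U]
  refine ⟨U, ⟨(elnitskyX w).leftWord_perm, (elnitskyX w).leftX_le_rightX hd, ?_, ?_, ?_, ?_⟩, ?_⟩
  · intro R hR
    obtain ⟨P, -, hRP⟩ := hmem.1 hR
    exact hrhombus P R hRP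
  · intro R hR y
    obtain ⟨P, hP, hRP⟩ := hmem.1 hR
    exact (hsub hRP y).trans (hT.slice_subset hd hP y)
  · intro R hR S hS hne y
    obtain ⟨P, hP, hRP⟩ := hmem.1 hR
    obtain ⟨Q, hQ, hSQ⟩ := hmem.1 hS
    rcases eq_or_ne P Q with rfl | hPQ
    · exact ElnitskyPolygon.disjoint_slice hd
        ((hUs P).disjoint_of_ne hd P.nodup hRP hSQ hne) y
    · exact (ElnitskyPolygon.disjoint_slice hd (hT.nonoverlapping P hP Q hQ hPQ) y).mono
        (hsub hRP y) (hsub hSQ y)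
  · intro y
    refine ((hT.finite_diff hd y).union
      (hT.finite.biUnion fun P _ => (hUs P).finite_diff hd y)).subset ?_
    rintro x ⟨hx, hxU⟩
    by_cases hxT : x ∈ ⋃ P ∈ T, P.slice d y
    · obtain ⟨P, hP, hxP⟩ := Set.mem_iUnion₂.1 hxT
      refine Or.inr (Set.mem_biUnion hP ⟨hxP, fun hxUs => hxU ?_⟩)
      obtain ⟨R, hR, hxR⟩ := Set.mem_iUnion₂.1 hxUs
      exact Set.mem_biUnion (hmem.2 ⟨P, hP, hR⟩) hxR
    · exact Or.inl ⟨hx, hxT⟩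
  · intro R hR
    obtain ⟨P, hP, hRP⟩ := hmem.1 hR
    exact ⟨P, hP, hsub hRP⟩

theorem isSeparatingPath (hd : IsEdgeSystem d) (hT : IsPawTiling d w T) (hP : P ∈ T)
    {U : Finset (ElnitskyPolygon n)} (hU : ∀ R ∈ U, ∃ Q ∈ T, ∀ y, R.slice d y ⊆ Q.slice d y) :
    IsSeparatingPath d 0 (elnitskyX w).leftWord (elnitskyX w).word U P.top P.word := by
  have hregion {y : ℝ} (hy : y ∈ Set.Icc (P.bottom d).2 P.top.2) :=
    (ElnitskyPolygon.mem_region hd).1 (hT.subset P hP (P.rightX_mem_region hd hy))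
  have hle := hd.add_wordSum_snd_le P.top P.word
  refine ⟨(hregion (Set.right_mem_Icc.2 hle)).1.2, (hregion (Set.left_mem_Icc.2 hle)).1.1,
    fun y hy => (hregion (Set.Ioo_subset_Icc_self hy)).2, fun y hy R hR hmem => ?_⟩
  obtain ⟨Q, hQ, hRQ⟩ := hU R hR
  rcases eq_or_ne P Q with rfl | hne
  · exact (hRQ y hmem).2.false
  · exact hT.notMem_slice hd hP hQ hne (P.rightX_mem_region hd (Set.Ioo_subset_Icc_self hy))
      (hRQ y hmem)

theorem exists_append_word_append (hd : IsEdgeSystem d) (hT : IsPawTiling d w T) (hP : P ∈ T)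
    (hne : P.word ≠ []) :
    ∃ α β, P.top = 0 + wordSum d α ∧ (α ++ P.word ++ β).Perm (elnitskyX w).word ∧
      WeakLE (α ++ P.word ++ β) (elnitskyX w).word := by
  obtain ⟨U, hfill, hU⟩ := hT.exists_isRhombicFilling hd
  obtain ⟨α, β, htop, -, U', hfill'⟩ := hfill.exists_append_append hd (elnitskyX w).nodup
    (hT.isSeparatingPath hd hP hU) hne
  exact ⟨α, β, htop, hfill'.perm, hfill'.weakLE hd (elnitskyX w).nodup⟩

end IsPawTiling

end TilingToFilling

/-! ### Isolated paws -/

section Isolated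

variable {n : ℕ} {d : Fin n → ℝ × ℝ} {w : Equiv.Perm (Fin n)} {P Q : ElnitskyPolygon n}

theorem exists_sweep_append_singleton (d : Fin n → ℝ × ℝ) {α β : List (Fin n)}
    (htop : P.top = 0 + wordSum d α) (hp : (α ++ P.word ++ β).Perm (elnitskyX w).word) :
    ∃ Ts, Sweep d 0 (elnitskyX w).leftWord (Ts ++ [P]) (α ++ P.word ++ β) ∧
      ∀ Q ∈ Ts, Q.IsRhombus := by
  have hp' : (α ++ P.leftWord ++ β).Perm (elnitskyX w).word :=
    (P.append_leftWord_append_perm α β).trans hp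
  obtain ⟨Ts, hsweep, hTs⟩ := ((elnitskyX w).leftWord_weakLE _).exists_sweep d 0
    (hp'.nodup_iff.2 (elnitskyX w).nodup) ((elnitskyX w).leftWord_perm.trans hp'.symm)
  exact ⟨Ts, hsweep.trans (.cons P α β htop (.nil _)), hTs⟩

theorem exists_mem_rhombicCompletions (hd : IsEdgeSystem d) {α β γ δ : List (Fin n)}
    (hP : P.top = 0 + wordSum d α) (hQ : Q.top = 0 + wordSum d γ) (hrhombus : Q.IsRhombus)
    (heq : α ++ P.word ++ β = γ ++ Q.leftWord ++ δ)
    (hp : (γ ++ Q.word ++ δ).Perm (elnitskyX w).word)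
    (hle : WeakLE (γ ++ Q.word ++ δ) (elnitskyX w).word) :
    ∃ S ∈ rhombicCompletions d w P, Q ∈ S := by
  obtain ⟨Ts, hbefore, hTs⟩ := exists_sweep_append_singleton d hP
    (heq ▸ (Q.append_leftWord_append_perm γ δ).trans hp)
  obtain ⟨Us, hafter, hUs⟩ := hle.exists_sweep d 0 (elnitskyX w).nodup hp
  rw [heq] at hbefore
  refine ⟨{R | R ∈ Ts ++ [P] ++ Q :: Us}, ⟨(hbefore.trans (.cons Q γ δ hQ hafter)).isPawTiling hd,
    by simp, fun R hR hRP => ?_⟩, by simp⟩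
  simp only [Set.mem_ofPred_eq, List.mem_append, List.mem_cons, List.not_mem_nil,
    or_false] at hR
  rcases hR with (hR | hR) | rfl | hR
  · exact hTs R hR
  · exact absurd hR hRP
  · exact hrhombus
  · exact hUs R hR

theorem ElnitskyPolygon.mem_edges_of_word_eq_pair {i j : Fin n} (hij : i < j)
    (hword : Q.word = [j, i]) {e : (ℝ × ℝ) × Fin n} :
    e ∈ Q.edges d ↔ e.2 = i ∧ (e.1 = Q.top ∨ e.1 = Q.top + d j) ∨
      e.2 = j ∧ (e.1 = Q.top ∨ e.1 = Q.top + d i) := by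
  have hleft := leftWord_of_word_eq_pair hij hword
  simp only [edges, leftEdges, rightEdges, hleft, hword, pathEdges, Prod.ext_iff, List.mem_append,
    List.mem_cons, List.not_mem_nil, or_false]
  tauto

theorem sharesTwoRightEdges_of_word_eq {u v : List (Fin n)} {i j : Fin n} (hij : i < j)
    (hQ : Q.word = [j, i]) (hP : P.word = u ++ i :: j :: v) (htop : Q.top = P.top + wordSum d u) :
    SharesTwoRightEdges d Q P := by
  refine ⟨(Q.top, i), ?_, (Q.top + d i, j), ?_, by simp [hij.ne],
    mem_pathEdges.2 ⟨u, j :: v, hP, htop⟩, mem_pathEdges.2 ⟨u ++ [i], v, by simp [hP], ?_⟩⟩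
  · simp [ElnitskyPolygon.mem_edges_of_word_eq_pair hij hQ]
  · simp [ElnitskyPolygon.mem_edges_of_word_eq_pair hij hQ]
  · simp [htop, wordSum, add_assoc]

theorem IsIsolatedPaw.pair_sublist_of_word_eq (hd : IsEdgeSystem d) {T : Set (ElnitskyPolygon n)}
    (h : IsIsolatedPaw d w T P) {α β u v : List (Fin n)} {i j : Fin n}
    (htop : P.top = 0 + wordSum d α) (hp : (α ++ P.word ++ β).Perm (elnitskyX w).word)
    (hle : WeakLE (α ++ P.word ++ β) (elnitskyX w).word) (hu : P.word = u ++ i :: j :: v) :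
    [i, j].Sublist (elnitskyX w).word := by
  by_contra hcon
  have hijP : [i, j].Sublist P.word := by simp [hu]
  have hijL : [i, j].Sublist (α ++ P.word ++ β) :=
    hijP.trans ((List.sublist_append_right _ _).trans (List.sublist_append_left _ _))
  have hne : i ≠ j := pair_sublist_ne P.nodup hijP
  have hij : i < j := hne.lt_of_le (not_lt.1 fun hji => hcon (hle j i hji hijL))
  have hji : [j, i].Sublist (elnitskyX w).word :=
    (pair_sublist_total hne (hp.subset (by simp [hu])) (hp.subset (by simp [hu]))).resolve_left
      hcon
  let Q : ElnitskyPolygon n := ⟨P.top + wordSum d u, [j, i], by simp [hij.ne']⟩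
  have hQ : Q.IsRhombus := ElnitskyPolygon.isRhombus_iff.2 ⟨i, j, hij, rfl⟩
  have hleft : Q.leftWord = [i, j] := ElnitskyPolygon.leftWord_of_word_eq_pair hij rfl
  have heq : α ++ P.word ++ β = (α ++ u) ++ i :: j :: (v ++ β) := by simp [hu]
  have hswap : (α ++ u) ++ Q.word ++ (v ++ β) = (α ++ u) ++ j :: i :: (v ++ β) := by simp [Q]
  rw [heq] at hp hle
  obtain ⟨S, hS, hQS⟩ := exists_mem_rhombicCompletions (β := β) hd htop
    (by simp [Q, htop, wordSum_append]) hQ (by simp [hu, hleft])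
    (hswap ▸ (perm_swap_middle _ _ _ _).symm.trans hp) (hswap ▸ hle.swap_of_pair_sublist hji)
  have hQP : Q ≠ P := fun hQP => pair_sublist_asymm Q.nodup (hQP ▸ hijP) (List.Sublist.refl _)
  exact h.2.2 S hS Q hQS hQP hQ (sharesTwoRightEdges_of_word_eq hij rfl hu rfl)

theorem IsIsolatedPaw.isStableFactor (hd : IsEdgeSystem d) {T : Set (ElnitskyPolygon n)}
    (h : IsIsolatedPaw d w T P) : IsStableFactor w P.word := by
  rcases eq_or_ne P.word [] with hnil | hne
  · rw [hnil]
    exact ⟨List.nil_sublist _, [], List.ofFn w, by simp, by simp [WeakLE.refl]⟩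
  obtain ⟨α, β, htop, hp, hle⟩ := h.1.exists_append_word_append hd h.2.1 hne
  exact ⟨sublist_of_pairwise_pair_sublist (elnitskyX w).nodup P.nodup
    (fun x hx => hp.subset (by simp [hx])) (pairwise_pair_sublist_of_adjacent (elnitskyX w).nodup
      fun u i j v hu => h.pair_sublist_of_word_eq hd htop hp hle hu), α, β, hp, hle⟩

theorem pathEdges_injOn_snd (a : ℝ × ℝ) {L : List (Fin n)} (hL : L.Nodup) :
    Set.InjOn Prod.snd {e | e ∈ pathEdges d a L} := by
  rintro ⟨x, i⟩ he ⟨x', i'⟩ he' rfl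
  obtain ⟨α, β, rfl, rfl⟩ := mem_pathEdges.1 he
  obtain ⟨α', β', heq, rfl⟩ := mem_pathEdges.1 he'
  obtain ⟨-, hβ, hα⟩ := List.nodup_append.1 (heq ▸ hL)
  rw [((List.append_cons_inj_of_notMem (fun h => hα i h i List.mem_cons_self rfl)
    (List.nodup_cons.1 hβ).1).1 heq.symm).1]

theorem SharesTwoRightEdges.exists_mem {i j : Fin n} (hij : i < j) (hQ : Q.word = [j, i])
    (h : SharesTwoRightEdges d Q P) :
    ∃ x y, ((x, i) ∈ P.rightEdges d ∧ (x = Q.top ∨ x = Q.top + d j)) ∧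
      ((y, j) ∈ P.rightEdges d ∧ (y = Q.top ∨ y = Q.top + d i)) := by
  obtain ⟨⟨x, a⟩, hx, ⟨y, b⟩, hy, hne, hxP, hyP⟩ := h
  have hab : a ≠ b := fun hab => hne (pathEdges_injOn_snd P.top P.nodup hxP hyP hab)
  rw [ElnitskyPolygon.mem_edges_of_word_eq_pair hij hQ] at hx hy
  obtain ⟨rfl, hx⟩ | ⟨rfl, hx⟩ := hx <;> obtain ⟨rfl, hy⟩ | ⟨rfl, hy⟩ := hy
  · exact absurd rfl hab
  · exact ⟨x, y, ⟨hxP, hx⟩, hyP, hy⟩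
  · exact ⟨y, x, ⟨hyP, hy⟩, hxP, hx⟩
  · exact absurd rfl hab

theorem SharesTwoRightEdges.exists_word_eq (hd : IsEdgeSystem d) {i j : Fin n} (hij : i < j)
    (hQ : Q.word = [j, i]) (hPij : ¬ [i, j].Sublist P.word) (h : SharesTwoRightEdges d Q P) :
    ∃ γ δ, P.word = γ ++ Q.word ++ δ ∧ Q.top = P.top + wordSum d γ := by
  obtain ⟨x, y, ⟨hxP, hx⟩, hyP, hy⟩ := h.exists_mem hij hQ
  obtain ⟨γ, η, hP, hyγ⟩ := mem_pathEdges.1 hyP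
  obtain ⟨α, β, hα, -⟩ := mem_pathEdges.1 hxP
  have hi : i ∈ γ ++ j :: η := hP ▸ hα ▸ by simp
  have hiγ : i ∉ γ := fun hiγ => hPij (hP ▸ pair_sublist_append.2 (.inr (.inl ⟨hiγ, by simp⟩)))
  obtain ⟨ε, δ, rfl⟩ := List.append_of_mem (show i ∈ η by simpa [hiγ, hij.ne] using hi)
  have hxε : x = y + d j + wordSum d ε := by
    have hmem : (y + d j + wordSum d ε, i) ∈ P.rightEdges d :=
      mem_pathEdges.2 ⟨γ ++ j :: ε, δ, by simp [hP], by
        rw [show y = _ from hyγ]; simp [wordSum, add_assoc]⟩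
    exact congrArg Prod.fst (pathEdges_injOn_snd P.top P.nodup hxP hmem rfl)
  have hle : x.2 ≤ (y + d j).2 := hxε ▸ hd.add_wordSum_snd_le _ ε
  -- The edge labelled `i` lies below the one labelled `j`, so they are the right border of `Q`.
  obtain ⟨rfl, rfl⟩ : x = Q.top + d j ∧ y = Q.top := by
    have hdi := hd.1 i
    have hdj := hd.1 j
    rcases hx with rfl | rfl <;> rcases hy with rfl | rfl
    · simp only [Prod.snd_add] at hle; linarith
    · simp only [Prod.snd_add] at hle; linarith
    · exact ⟨rfl, rfl⟩
    · simp only [Prod.snd_add] at hle; linarith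
  obtain rfl : ε = [] := by
    by_contra hε
    exact (hd.add_wordSum_snd_lt (Q.top + d j) hε).ne (congrArg Prod.snd hxε.symm)
  exact ⟨γ, δ, by simpa [hQ] using hP, hyγ⟩

theorem ElnitskyPolygon.slice_subset_of_word_eq (hd : IsEdgeSystem d) {γ δ : List (Fin n)}
    (hword : P.word = γ ++ Q.word ++ δ) (htop : Q.top = P.top + wordSum d γ) (y : ℝ) :
    Q.slice d y ⊆ P.slice d y := by
  have hp : P.leftWord.Perm (γ ++ Q.leftWord ++ δ) :=
    P.leftWord_perm.trans (hword ▸ (Q.append_leftWord_append_perm γ δ).symm)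
  have hle : P.leftX d y ≤ pathX d P.top (γ ++ Q.leftWord ++ δ) y :=
    (P.leftWord_weakLE _).pathX_le hd
      ((hp.symm.trans P.leftWord_perm).nodup_iff.2 P.nodup) hp P.top y
  rcases Q.pathX_append_leftWord_append hd htop δ y with ⟨-, hl, hr⟩ | ⟨-, heq⟩
  · refine Set.Ioo_subset_Ioo (hl ▸ hle) (le_of_eq ?_)
    rw [← hr, ← hword, ElnitskyPolygon.rightX]
  · simp [ElnitskyPolygon.slice, heq]

theorem IsPawTiling.not_sharesTwoRightEdges (hd : IsEdgeSystem d) {S : Set (ElnitskyPolygon n)}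
    (hS : IsPawTiling d w S) (hP : P ∈ S) (hQ : Q ∈ S) (hne : Q ≠ P) (hrhombus : Q.IsRhombus)
    (hsub : P.word.Sublist (List.ofFn w)) : ¬ SharesTwoRightEdges d Q P := by
  intro hshare
  obtain ⟨i, j, hij, hword⟩ := ElnitskyPolygon.isRhombus_iff.1 hrhombus
  obtain ⟨α, β, -, -, hle⟩ := hS.exists_append_word_append hd hQ (by simp [hword])
  have hji : [j, i].Sublist (List.ofFn w) := hle i j hij <| hword ▸
    (List.sublist_append_right _ _).trans (List.sublist_append_left _ _)
  obtain ⟨γ, δ, hPword, htop⟩ := hshare.exists_word_eq hd hij hword fun hPij =>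
    pair_sublist_asymm (nodup_ofFn_perm w) hji (hPij.trans hsub)
  obtain ⟨y, hy⟩ : (Set.Ioo (Q.bottom d).2 Q.top.2).Nonempty :=
    Set.nonempty_Ioo.2 (hd.add_wordSum_snd_lt Q.top (by simp [hword]))
  obtain ⟨x, hx⟩ : (Q.slice d y).Nonempty :=
    Set.nonempty_Ioo.2 (hrhombus.leftX_lt_rightX hd hy)
  exact Set.disjoint_left.1
    (ElnitskyPolygon.disjoint_slice hd (hS.nonoverlapping Q hQ P hP hne) y) hx
    (ElnitskyPolygon.slice_subset_of_word_eq hd hPword htop y hx)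

theorem IsStableFactor.exists_isIsolatedPaw (hd : IsEdgeSystem d) {u : List (Fin n)}
    (h : IsStableFactor w u) : ∃ T P, P.word = u ∧ IsIsolatedPaw d w T P := by
  obtain ⟨hsub, α, β, hp, hle⟩ := h
  let P : ElnitskyPolygon n := ⟨0 + wordSum d α, u, hsub.nodup (elnitskyX w).nodup⟩
  obtain ⟨Ts, hbefore, -⟩ := exists_sweep_append_singleton (P := P) d rfl hp
  obtain ⟨Us, hafter, -⟩ := hle.exists_sweep d 0 (elnitskyX w).nodup hp
  exact ⟨{Q | Q ∈ Ts ++ [P] ++ Us}, P, rfl, (hbefore.trans hafter).isPawTiling hd, by simp,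
    fun S hS Q hQ hne hrhombus => hS.1.not_sharesTwoRightEdges hd hS.2.1 hQ hne hrhombus hsub⟩

end Isolated

theorem corollary4p12 {n k : ℕ} (d : Fin n → ℝ × ℝ) (hd : IsEdgeSystem d)
    (w : Equiv.Perm (Fin n)) (p : Equiv.Perm (Fin k)) (I : Finset (Fin n)) :
    (∃ T : Set (ElnitskyPolygon n), IsPawTiling d w T ∧
      ∃ P ∈ T, P.HasShape p ∧ P.labels = I ∧ IsIsolatedPaw d w T P) ↔
    (ValueStable p w ∧ IsValueStableOccurrence p w I) := by
  constructor
  · rintro ⟨T, -, P, -, hshape, rfl, hiso⟩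
    obtain ⟨f, hword, hf⟩ := ElnitskyPolygon.hasShape_iff_exists_ofFn.1 hshape
    have hocc : IsValueStableOccurrence p w P.labels :=
      isValueStableOccurrence_iff.2 ⟨f, hf,
        (ElnitskyPolygon.labels_eq_image hword).symm, hword ▸ hiso.isStableFactor hd⟩
    exact ⟨hocc.valueStable, hocc⟩
  · rintro ⟨-, hocc⟩
    obtain ⟨f, hf, rfl, hstable⟩ := isValueStableOccurrence_iff.1 hocc
    obtain ⟨T, P, hword, hiso⟩ := hstable.exists_isIsolatedPaw hd
    exact ⟨T, hiso.1, P, hiso.2.1, ElnitskyPolygon.hasShape_iff_exists_ofFn.2 ⟨f, hword, hf⟩,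
      ElnitskyPolygon.labels_eq_image hword, hiso⟩
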